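/- **Definitions.** A *tree walk* of size $m\ge 1$ is a closed walk on the complete graph with vertex set $[m]=\{1,\dots,m\}$ (with a starting vertex, the root, and possibly of length $0$) which visits every vertex and whose traversed edges form a tree, its induced tree. An edge of this tree is *simple* if it is traversed exactly twice; an edge traversed $2k$ times has excess $k-1$, and the *excess* of the walk is the sum of the excesses of the edges of its induced tree. A leaf is a vertex of degree $1$ (possibly the root). The *kernel* of a tree walk is obtained as follows: (i) while some leaf other than the root is incident to a simple edge, delete both occurrences of this edge from the walk; (ii) while the root is a leaf incident to a simple edge, delete both occurrences of this edge and move the root to its other endpoint; (iii) while some vertex $x$ other than the root is incident to exactly two edges $\{a,x\}$ and $\{x,b\}$, both simple, replace the two passages $a,x,b$ and $b,x,a$ of the walk by $a,b$ and $b,a$. A *kernel walk* is a tree walk that equals its own kernel. A *superreduced walk* is a tree walk without simple edges. Let $k_{\xi,s,2\ell}$ be the number of kernel walks of length $2\ell$ and excess $\xi$ with $s$ simple edges, $s_{m,2\ell}$ the number of superreduced walks of size $m$ and length $2\ell$, and $s_{\xi,m,2\ell}$ the number of those of excess $\xi$. Define the formal power series over $\mathbb Q$ $$K_\xi(u,v,z)=\sum_{\substack{s,\ell\ge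 0\\ \ell-\xi+1\ge 0}}k_{\xi,s,2\ell}\,u^s\frac{v^{\ell-\xi+1}}{(\ell-\xi+1)!}z^\ell,\qquad K(u,v,z)=\sum_{\xi\ge0}K_\xi(u,v,z),$$ $$S(v,z)=\sum_{m,\ell\ge0}s_{m,2\ell}\frac{v^m}{m!}z^\ell,\qquad S_\xi(v,z)=\sum_{m,\ell\ge0}s_{\xi,m,2\ell}\frac{v^m}{m!}z^\ell,\qquad S_{\le\xi}=\sum_{k=0}^{\xi}S_k .$$ **Statement.** The sum defining $K$ is coefficientwise finite, and as formal power series $$K(u,v,z)=\frac{1}{1-uz(K(u,v,z)-v)}\,S\!\left(v,\frac{z}{\bigl(1-uz(K(u,v,z)-v)\bigr)^2}\right)-uvz\,(K(u,v,z)-v).$$ Moreover $$K(u,v,z)=S(v,z)+\sum_{s\ge1}\frac{u^s}{s+1}[t^s]\left(\frac{1}{1-zt}\,S\!\left(v,\frac{z}{(1-zt)^2}\right)-vzt-v\right)^{s+1}.$$ Finally, for every $\xi\ge0$ the series $S_{\le\xi}(v,z)$ is a polynomial, and $$K_\xi(u,v,z)=S_\xi(v,z)+\sum_{s=1}^{2\xi-2}\frac{u^s}{s+1}[t^sy^{\xi-1}]\left(\frac{1}{1-yzt}\,S_{\le\xi}\!\left(\frac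 vy,\frac{yz}{(1-yzt)^2}\right)-vzt-\frac vy\right)^{s+1},$$ where the expression in parentheses is a Laurent series in $y$ with coefficients in $\mathbb Q[[t,v,z]]$, and the sum over $s$ is empty for $\xi\le1$. -/

import Mathlib

open MvPowerSeries

namespace TreeWalks

section Walks

variable {V : Type*} [DecidableEq V]

/-- A closed walk on the complete graph with vertex set `V`: a starting vertex (the root) together
with a walk from this vertex to itself. The length may be `0`. -/
abbrev ClosedWalk (V : Type*) := Σ r : V, (⊤ : SimpleGraph V).Walk r r

/-- The graph induced by a closed walk: the visited vertices and the traversed edges. -/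
def inducedGraph (W : ClosedWalk V) : (⊤ : SimpleGraph V).Subgraph := W.2.toSubgraph

/-- A tree walk on the label set `V`: a closed walk which visits every vertex and whose induced
graph is a tree. Its size is the cardinality of `V`. -/
def IsTreeWalk (W : ClosedWalk V) : Prop :=
  (∀ x : V, x ∈ W.2.support) ∧ (inducedGraph W).coe.IsTree

/-- An edge of the induced graph is simple if it is traversed exactly twice. -/
def IsSimpleEdge (W : ClosedWalk V) (e : Sym2 V) : Prop := W.2.edges.count e = 2

instance (W : ClosedWalk V) (e : Sym2 V) : Decidable (IsSimpleEdge W e) :=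
  inferInstanceAs (Decidable (W.2.edges.count e = 2))

/-- An edge traversed `2k` times has excess `k - 1`; the excess of a walk is the sum of the
excesses of the edges of its induced graph. -/
def excess (W : ClosedWalk V) : ℕ := ∑ e ∈ W.2.edges.toFinset, (W.2.edges.count e / 2 - 1)

/-- The number of simple edges of the induced graph. -/
def numSimple (W : ClosedWalk V) : ℕ := (W.2.edges.toFinset.filter (IsSimpleEdge W)).card

/-- A leaf of the induced graph: a vertex of degree one (the root is allowed). -/
def IsLeaf (W : ClosedWalk V) (x : V) : Prop := ((inducedGraph W).neighborSet x).ncard = 1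

/-! The reduction of a tree walk to its kernel. The walks are not relabelled after a vertex has
disappeared; the induced tree is always that of the visited vertices. -/

/-- `x` is a leaf, not the root, incident to the simple edge `{x, y}`. -/
def CanPrune (W : ClosedWalk V) (x y : V) : Prop :=
  x ≠ W.1 ∧ IsLeaf W x ∧ IsSimpleEdge W s(x, y)

/-- Delete both occurrences of a simple edge incident to a leaf which is not the root. -/
def PruneStep (W W' : ClosedWalk V) : Prop :=
  ∃ x y, CanPrune W x y ∧ W'.1 = W.1 ∧ W'.2.edges = W.2.edges.filter (· ≠ s(x, y))

/-- The root is a leaf and incident to the simple edge `{root, y}`. -/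
def CanMoveRoot (W : ClosedWalk V) (y : V) : Prop :=
  IsLeaf W W.1 ∧ IsSimpleEdge W s(W.1, y)

/-- Delete both occurrences of the simple edge at a root which is a leaf, and move the root to the
other endpoint of this edge. -/
def MoveRootStep (W W' : ClosedWalk V) : Prop :=
  ∃ y, CanMoveRoot W y ∧ W'.1 = y ∧ W'.2.edges = W.2.edges.filter (· ≠ s(W.1, y))

/-- `x` is not the root and is incident to exactly two edges `{x, a}`, `{x, b}`, both simple. -/
def CanSmooth (W : ClosedWalk V) (x a b : V) : Prop :=
  x ≠ W.1 ∧ a ≠ b ∧ (inducedGraph W).neighborSet x = {a, b} ∧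
    IsSimpleEdge W s(x, a) ∧ IsSimpleEdge W s(x, b)

/-- Replace the two passages `a, x, b` and `b, x, a` of the walk by `a, b` and `b, a`: this removes
`x` from the sequence of visited vertices. -/
def SmoothStep (W W' : ClosedWalk V) : Prop :=
  ∃ x a b, CanSmooth W x a b ∧ W'.2.support = W.2.support.filter (· ≠ x)

/-- `W'` is a kernel of `W`: it is obtained from `W` by pruning as long as possible, then moving
the root as long as possible, then smoothing as long as possible. -/
def IsKernelOf (W' W : ClosedWalk V) : Prop :=
  ∃ W₁ W₂ : ClosedWalk V,
    Relation.ReflTransGen PruneStep W W₁ ∧ (∀ x y, ¬ CanPrune W₁ x y) ∧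
    Relation.ReflTransGen MoveRootStep W₁ W₂ ∧ (∀ y, ¬ CanMoveRoot W₂ y) ∧
    Relation.ReflTransGen SmoothStep W₂ W' ∧ (∀ x a b, ¬ CanSmooth W' x a b)

/-- A kernel walk is a tree walk which is its own kernel. -/
def IsKernelWalk (W : ClosedWalk V) : Prop := IsTreeWalk W ∧ IsKernelOf W W

/-- A superreduced walk is a tree walk without simple edges. -/
def IsSuperreduced (W : ClosedWalk V) : Prop :=
  IsTreeWalk W ∧ ∀ e ∈ W.2.edges, ¬ IsSimpleEdge W e

end Walks

/-- The number of kernel walks (of any size `m`, on the labels `Fin m`) of length `2ℓ` and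
excess `ξ` whose induced tree has `s` simple edges. -/
noncomputable def kernelCount (ξ s ℓ : ℕ) : ℕ :=
  Nat.card (Σ m : ℕ, {W : ClosedWalk (Fin m) //
    IsKernelWalk W ∧ W.2.length = 2 * ℓ ∧ excess W = ξ ∧ numSimple W = s})

/-- The number of superreduced walks of size `m` and length `2ℓ`. -/
noncomputable def superCount (m ℓ : ℕ) : ℕ :=
  Nat.card {W : ClosedWalk (Fin m) // IsSuperreduced W ∧ W.2.length = 2 * ℓ}

/-- The number of superreduced walks of size `m`, length `2ℓ` and excess `ξ`. -/
noncomputable def superCountExcess (ξ m ℓ : ℕ) : ℕ :=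
  Nat.card {W : ClosedWalk (Fin m) // IsSuperreduced W ∧ W.2.length = 2 * ℓ ∧ excess W = ξ}

/-- `K_ξ(u, v, z) = ∑_{s, ℓ} k_{ξ, s, 2ℓ} u^s v^(ℓ - ξ + 1) / (ℓ - ξ + 1)! z^ℓ`, where `u`, `v`, `z`
are the variables `0`, `1`, `2`. -/
noncomputable def kernelGFExcess (ξ : ℕ) : MvPowerSeries (Fin 3) ℚ := fun d =>
  if d 1 + ξ = d 2 + 1 then (kernelCount ξ (d 0) (d 2) : ℚ) / (d 1).factorial else 0

/-- `K(u, v, z) = ∑_ξ K_ξ(u, v, z)`, summed coefficientwise. -/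
noncomputable def kernelGF : MvPowerSeries (Fin 3) ℚ := fun d =>
  ∑ᶠ ξ : ℕ, coeff d (kernelGFExcess ξ)

/-- `S(v, z) = ∑_{m, ℓ} s_{m, 2ℓ} v^m / m! z^ℓ`, where `v`, `z` are the variables `0`, `1`. -/
noncomputable def superGF : MvPowerSeries (Fin 2) ℚ := fun d =>
  (superCount (d 0) (d 1) : ℚ) / (d 0).factorial

/-- `S_ξ(v, z)`: the part of `S(v, z)` coming from the walks of excess `ξ`. -/
noncomputable def superGFExcess (ξ : ℕ) : MvPowerSeries (Fin 2) ℚ := fun d =>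
  (superCountExcess ξ (d 0) (d 1) : ℚ) / (d 0).factorial

/-- `S_{≤ ξ}(v, z) = ∑_{k ≤ ξ} S_k(v, z)`. -/
noncomputable def superGFExcessLE (ξ : ℕ) : MvPowerSeries (Fin 2) ℚ :=
  ∑ k ∈ Finset.range (ξ + 1), superGFExcess k

/-- A series in three variables `w, v, z` (numbered `0`, `1`, `2`) as a power series in the first
variable `w` with coefficients in `ℚ⟦v, z⟧`. -/
noncomputable abbrev expandFirst :
    MvPowerSeries (Fin 3) ℚ ≃ₐ[ℚ] PowerSeries (MvPowerSeries (Fin 2) ℚ) :=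
  finSuccEquiv ℚ 2

/-- For a series `F(v, z)` and series `a`, `b` without constant term: `F(a, b)`. -/
noncomputable abbrev substTwo (F : MvPowerSeries (Fin 2) ℚ) (a b : MvPowerSeries (Fin 3) ℚ) :
    MvPowerSeries (Fin 3) ℚ :=
  MvPowerSeries.subst ![a, b] F

/-- `Φ(t, v, z) = 1 / (1 - z t) * S(v, z / (1 - z t)^2) - v z t - v`, where `t`, `v`, `z` are the
variables `0`, `1`, `2`. -/
noncomputable def lagrangeSeries : MvPowerSeries (Fin 3) ℚ :=
  let t : MvPowerSeries (Fin 3) ℚ := X 0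
  let v : MvPowerSeries (Fin 3) ℚ := X 1
  let z : MvPowerSeries (Fin 3) ℚ := X 2
  (1 - z * t)⁻¹ * substTwo superGF v (z * ((1 - z * t) ^ 2)⁻¹) - v * z * t - v

/-- `1 / (1 - y z t) * P(v / y, y z / (1 - y z t)^2) - v z t - v / y` for a polynomial `P(v, z)`, as
a Laurent series in `y` with coefficients in `ℚ⟦t, v, z⟧`; here `HahnSeries.single n c` is `c y^n`,
and `1 - y z t` is invertible since it is a power series in `y` with constant term `1`. -/
noncomputable def lagrangeLaurent (P : MvPolynomial (Fin 2) ℚ) :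
    LaurentSeries (MvPowerSeries (Fin 3) ℚ) :=
  let t : MvPowerSeries (Fin 3) ℚ := X 0
  let v : MvPowerSeries (Fin 3) ℚ := X 1
  let z : MvPowerSeries (Fin 3) ℚ := X 2
  let yz : LaurentSeries (MvPowerSeries (Fin 3) ℚ) := HahnSeries.single 1 z
  let vDivY : LaurentSeries (MvPowerSeries (Fin 3) ℚ) := HahnSeries.single (-1) v
  let Q : LaurentSeries (MvPowerSeries (Fin 3) ℚ) :=
    Ring.inverse (1 - yz * HahnSeries.C t)
  Q * MvPolynomial.aeval ![vDivY, yz * Q ^ 2] P - HahnSeries.C (v * z * t) - vDivY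

end TreeWalks

/-! A tree walk is encoded by its list of vertices. Drop the kernel condition at the root, and let
`R_p` be the generating function of the resulting rooted kernel walks which have at least `p` steps,
the first `p` of them along non-simple edges (`rootedFrom p`). Look at the next step. If there is
none, the walk is superreduced of length `p`. If it is not simple, the walk counts in `R_(p+1)`. If
it is simple, the edge `{x, y}` is crossed once in each direction, and the part of the walk between
the two crossings is a closed walk from `y`. Cutting it out leaves a walk of `R_p` and a kernel walk
of positive length, and every such pair on disjoint labels arises once
(`IsInsertion.isRootedKernel_iff`, `exists_insertWalk_eq`, `insertWalk_injective`). With `D = 1 - u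
z (K - v)` this says `D R_p = R_(p+1) + S_p`, where `S_p` counts superreduced walks of length `p`
and vanishes for odd `p`. Iteration gives `R_0 = D⁻¹ S(v, z / D²)`. A rooted kernel walk fails to be
a kernel walk only if its root is a leaf at a simple edge, so `R_0 = K + u v z (K - v)`, and the
functional equation follows (`kernelGF_functional`).

Put `f = u (K - v)`. The functional equation reads `f = u Φ(f)` with `Φ = lagrangeSeries`, so the
expansion in `u` is Lagrange inversion (`lagrange_inversion`, `coeff_expandFirst_kernelGF`).

For fixed excess, `ℓ - m = ξ - 1` is the weight of a monomial, and marking it by `y` turns `Φ` into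
the Laurent series of the statement (`IsGrading`). All monomials of `Φ` have nonnegative weight, so
those terms of `S` with `ℓ - m ≥ ξ` cannot reach weight `ξ - 1`, and `S` may be replaced by `S_{≤
ξ}`. All monomials of `Φ` even satisfy `2 (ℓ - m) - s ≥ 0`, whence `s ≤ 2 ξ - 2`. -/

namespace TreeWalks

/-! ### Closed walks as lists of vertices; parity of edge traversals in a tree. -/

section Lists

set_option linter.unusedSectionVars false

variable {α : Type*} [DecidableEq α]

/-- The edges traversed by the walk with list of vertices `L`. -/
def pairs : List α → List (Sym2 α)
  | [] => []
  | [_] => []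
  | a :: b :: l => s(a, b) :: pairs (b :: l)

@[simp] lemma pairs_nil : pairs ([] : List α) = [] := rfl
@[simp] lemma pairs_singleton (a : α) : pairs [a] = [] := rfl
@[simp] lemma pairs_cons_cons (a b : α) (l : List α) :
    pairs (a :: b :: l) = s(a, b) :: pairs (b :: l) := rfl

lemma length_pairs (L : List α) : (pairs L).length = L.length - 1 := by
  induction L with
  | nil => rfl
  | cons a l ih => cases l <;> simp_all

lemma pairs_append (A B : List α) (hA : A ≠ []) (hB : B ≠ []) :
    pairs (A ++ B) = pairs A ++ s(A.getLast hA, B.head hB) :: pairs B := by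
  induction A with
  | nil => exact absurd rfl hA
  | cons a l ih =>
    cases l with
    | nil =>
      cases B with
      | nil => exact absurd rfl hB
      | cons b B => simp
    | cons b l => simpa using ih (by simp)

lemma pairs_append_cons (P Q : List α) (x : α) :
    pairs (P ++ x :: Q) = pairs (P ++ [x]) ++ pairs (x :: Q) := by
  induction P with
  | nil => simp
  | cons a l ih => cases l <;> simp_all

lemma mem_of_mem_pairs {L : List α} {e : Sym2 α} (he : e ∈ pairs L) {a : α} (ha : a ∈ e) :
    a ∈ L := by
  induction L with
  | nil => simp at he
  | cons b l ih =>
    cases l with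
    | nil => simp at he
    | cons c l =>
      simp only [pairs_cons_cons, List.mem_cons] at he ih ⊢
      rcases he with rfl | he
      · simp only [Sym2.mem_iff] at ha
        tauto
      · exact Or.inr (ih he)

lemma pairs_map {β : Type*} (f : α → β) (L : List α) :
    pairs (L.map f) = (pairs L).map (Sym2.map f) := by
  induction L with
  | nil => rfl
  | cons a l ih => cases l <;> simp_all

lemma take_pairs {P Q : List α} {x : α} :
    (pairs (P ++ x :: Q)).take P.length = pairs (P ++ [x]) := by
  rw [pairs_append_cons, List.take_left' (by simp [length_pairs])]

/-- Prepending a new vertex always uses a new edge. The lists attaining equality are exactly those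
whose induced graph is a tree, up to loops. -/
lemma card_toFinset_le (L : List α) : L.toFinset.card ≤ (pairs L).toFinset.card + 1 := by
  induction L with
  | nil => simp
  | cons a l ih =>
    cases l with
    | nil => simp
    | cons b l =>
      rw [pairs_cons_cons, List.toFinset_cons, List.toFinset_cons (l := pairs _)]
      by_cases ha : a ∈ b :: l
      · rw [Finset.insert_eq_of_mem (List.mem_toFinset.2 ha)]
        exact ih.trans (by gcongr; exact Finset.subset_insert _ _)
      · rw [Finset.card_insert_of_notMem (by rwa [List.mem_toFinset]),
          Finset.card_insert_of_notMem]
        · omega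
        · exact fun h => ha (mem_of_mem_pairs (List.mem_toFinset.1 h) (Sym2.mem_mk_left _ _))

/-- `c` changes along the edge `e` and along no other edge of the walk. -/
def Separates (L : List α) (e : Sym2 α) (c : α → Bool) : Prop :=
  ∀ a b, s(a, b) ∈ pairs L → (c a ≠ c b ↔ s(a, b) = e)

/-- In a tree the two sides of an edge can be coloured. Equality of the counts survives removal of
the first vertex `a`, because a vertex and an edge are lost together or not at all. If `a` is lost,
it was a leaf: it is coloured alone when `e` is its edge, and otherwise it copies the colour of its
neighbour. -/
lemma exists_separates {L : List α} (h : L.toFinset.card = (pairs L).toFinset.card + 1)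
    {e : Sym2 α} (he : e ∈ pairs L) : ∃ c, Separates L e c := by
  induction L with
  | nil => simp at he
  | cons a l ih =>
    cases l with
    | nil => simp at he
    | cons b l =>
      have hle := card_toFinset_le (b :: l)
      rw [pairs_cons_cons, List.toFinset_cons, List.toFinset_cons (l := pairs _)] at h
      simp only [Separates, pairs_cons_cons, List.mem_cons] at he ⊢
      by_cases ha : a ∈ b :: l
      · rw [Finset.insert_eq_of_mem (List.mem_toFinset.2 ha)] at h
        have hm : s(a, b) ∈ pairs (b :: l) := by
          by_contra hm
          rw [Finset.card_insert_of_notMem (by rwa [List.mem_toFinset])] at h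
          omega
        rw [Finset.insert_eq_of_mem (List.mem_toFinset.2 hm)] at h
        obtain ⟨c, hc⟩ := ih h (by rcases he with rfl | he <;> assumption)
        refine ⟨c, fun p q hpq => hc p q ?_⟩
        rcases hpq with hpq | hpq
        · rwa [hpq]
        · exact hpq
      · have hn : s(a, b) ∉ pairs (b :: l) :=
          fun h => ha (mem_of_mem_pairs h (Sym2.mem_mk_left _ _))
        have hab : b ≠ a := by rintro rfl; simp at ha
        rw [Finset.card_insert_of_notMem (by rwa [List.mem_toFinset]),
          Finset.card_insert_of_notMem (by rwa [List.mem_toFinset])] at h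
        have hne : ∀ {p q}, s(p, q) ∈ pairs (b :: l) → p ≠ a ∧ q ≠ a := fun {p q} h => by
          constructor
          · rintro rfl; exact ha (mem_of_mem_pairs h (Sym2.mem_mk_left _ _))
          · rintro rfl; exact ha (mem_of_mem_pairs h (Sym2.mem_mk_right _ _))
        rcases he with rfl | he
        · refine ⟨fun x => decide (x = a), fun p q hpq => ?_⟩
          rcases hpq with hpq | hpq
          · simp only [hpq, iff_true]
            rw [Sym2.eq_iff] at hpq
            rcases hpq with ⟨rfl, rfl⟩ | ⟨rfl, rfl⟩ <;> simp [hab]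
          · have := hne hpq
            simp only [this.1, this.2, ne_eq, not_true_eq_false, false_iff]
            rintro h
            exact hn (h ▸ hpq)
        · obtain ⟨c, hc⟩ := ih (by omega) he
          refine ⟨Function.update c a (c b), fun p q hpq => ?_⟩
          rcases hpq with hpq | hpq
          · have : s(p, q) ≠ e := by rintro rfl; exact hn (hpq ▸ he)
            simp only [this, iff_false, not_not]
            rw [Sym2.eq_iff] at hpq
            rcases hpq with ⟨rfl, rfl⟩ | ⟨rfl, rfl⟩ <;> simp [hab]
          · have := hne hpq
            rw [Function.update_of_ne this.1, Function.update_of_ne this.2]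
            exact hc p q hpq

/-- The colour flips exactly at the traversals of `e`. -/
lemma Separates.even_count_iff {e : Sym2 α} {c : α → Bool} {a : α} {l : List α}
    (h : Separates (a :: l) e c) :
    Even ((pairs (a :: l)).count e) ↔ c a = c ((a :: l).getLast (by simp)) := by
  induction l generalizing a with
  | nil => simp
  | cons b l ih =>
    have h1 := h a b (by simp)
    have h2 := ih (a := b) fun p q hpq => h p q (by simp [hpq])
    rw [pairs_cons_cons, List.getLast_cons (by simp), List.count_cons]
    by_cases hab : s(a, b) = e
    · simp only [hab, beq_self_eq_true, if_true, Nat.even_add_one, h2]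
      have := h1.2 hab
      revert this
      cases c a <;> cases c b <;> simp
    · have : c a = c b := by
        by_contra hne
        exact hab (h1.1 hne)
      simp [hab, h2, this]

lemma Separates.eq_of_notMem {e : Sym2 α} {c : α → Bool} {L : List α} (h : Separates L e c)
    (he : e ∉ pairs L) {a b : α} (ha : a ∈ L) (hb : b ∈ L) : c a = c b := by
  -- It is enough to compare every vertex with the first one.
  suffices H : ∀ l : List α, ∀ a, Separates (a :: l) e c → e ∉ pairs (a :: l) →
      ∀ b ∈ a :: l, c b = c a by
    cases L with
    | nil => simp at ha
    | cons r l => rw [H l r h he a ha, H l r h he b hb]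
  clear! L a b
  intro l
  induction l with
  | nil => simp
  | cons d l ih =>
    intro a h he b hb
    have h1 := h a d (by simp)
    have h2 := ih d (fun p q hpq => h p q (by simp [hpq])) (fun h => he (by simp [h]))
    have : c a = c d := by
      by_contra hne
      exact he (by simp [h1.1 hne])
    rcases List.mem_cons.1 hb with rfl | hb
    · rfl
    · rw [h2 b hb, this]

/-- The cut is at the first traversal of `e`. -/
lemma exists_split_of_mem_pairs {L : List α} {e : Sym2 α} (he : e ∈ pairs L) :
    ∃ A B, ∃ (hA : A ≠ []) (hB : B ≠ []), L = A ++ B ∧ e = s(A.getLast hA, B.head hB) ∧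
      e ∉ pairs A := by
  induction L with
  | nil => simp at he
  | cons a l ih =>
    cases l with
    | nil => simp at he
    | cons b l =>
      by_cases hab : e = s(a, b)
      · exact ⟨[a], b :: l, by simp, by simp, by simp, by simpa using hab, by simp⟩
      · simp only [pairs_cons_cons, List.mem_cons, hab, false_or] at he
        obtain ⟨A, B, hA, hB, h1, h2, h3⟩ := ih he
        refine ⟨a :: A, B, by simp, hB, by simp [h1], by rw [h2, List.getLast_cons hA], ?_⟩
        cases A with
        | nil => simp at hA
        | cons d A =>
          simp only [List.cons_append, List.cons.injEq] at h1
          obtain ⟨rfl, -⟩ := h1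
          simp [h3, hab]

/-- The list of vertices of a closed walk whose edges form a tree. -/
def IsTreeList (L : List α) : Prop :=
  (∀ e ∈ pairs L, ¬ e.IsDiag) ∧ L.head? = L.getLast? ∧
    L.toFinset.card = (pairs L).toFinset.card + 1

lemma IsTreeList.ne_nil {L : List α} (h : IsTreeList L) : L ≠ [] := by
  rintro rfl
  simpa using h.2.2

/-- A closed walk returns to its initial side of the edge. -/
lemma IsTreeList.even_count {L : List α} (h : IsTreeList L) (e : Sym2 α) :
    Even ((pairs L).count e) := by
  by_cases he : e ∈ pairs L
  · obtain ⟨c, hc⟩ := exists_separates h.2.2 he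
    cases L with
    | nil => simp at he
    | cons a l =>
      rw [hc.even_count_iff]
      have := h.2.1
      rw [List.getLast?_eq_getLast_of_ne_nil (by simp), List.head?_cons, Option.some_inj] at this
      rw [← this]
  · simp [List.count_eq_zero_of_not_mem he]

lemma IsTreeList.even_length_pairs {L : List α} (h : IsTreeList L) : Even (pairs L).length := by
  rw [← List.sum_toFinset_count_eq_length]
  exact Finset.even_sum _ fun e _ => h.even_count e

/-- The edges of the walk at the vertex `x`. -/
def star (L : List α) (x : α) : Finset (Sym2 α) := (pairs L).toFinset.filter (x ∈ ·)

lemma mem_star {L : List α} {x : α} {e : Sym2 α} : e ∈ star L x ↔ e ∈ pairs L ∧ x ∈ e := by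
  simp [star]

/-- Some edge at `x` is not simple. -/
def Thick (L : List α) (x : α) : Prop := ∃ e ∈ star L x, (pairs L).count e ≠ 2

/-- The tree walks which satisfy the kernel conditions at all vertices other than the root. -/
def IsRootedKernel (L : List α) : Prop :=
  IsTreeList L ∧ ∀ x ∈ L, L.head? ≠ some x → (star L x).card = 1 ∨ (star L x).card = 2 → Thick L x

/-- The lists of vertices of kernel walks. -/
def IsKernelList (L : List α) : Prop :=
  IsRootedKernel L ∧ ∀ x ∈ L, L.head? = some x → (star L x).card = 1 → Thick L x

/-- The lists of vertices of superreduced walks. -/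
def IsSuperreducedList (L : List α) : Prop :=
  IsTreeList L ∧ ∀ e ∈ pairs L, (pairs L).count e ≠ 2

/-- The rooted kernel walks of length at least `p` whose first `p` edges are not simple. -/
def IsRootedKernelFrom (p : ℕ) (L : List α) : Prop :=
  IsRootedKernel L ∧ p < L.length ∧ ∀ e ∈ (pairs L).take p, (pairs L).count e ≠ 2

/-- The simple edges of a walk. -/
def simpleEdges (L : List α) : Finset (Sym2 α) :=
  (pairs L).toFinset.filter ((pairs L).count · = 2)

end Lists

/-! ### Inserting and cutting out an excursion along a simple edge. -/

section Insertion

set_option linter.unusedSectionVars false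

variable {α : Type*} [DecidableEq α]

/-- `L` arises from the walk `L'` by inserting at an occurrence of `x` an excursion along the new
edge `{x, y}`, with the closed walk `Y` from `y` to `y` on new vertices. -/
structure IsInsertion (L L' Y : List α) (x y : α) : Prop where
  perm : (pairs L).Perm (s(x, y) :: s(x, y) :: (pairs Y ++ pairs L'))
  toFinset_eq : L.toFinset = L'.toFinset ∪ Y.toFinset
  disj : Disjoint L'.toFinset Y.toFinset
  left_mem : x ∈ L'
  right_mem : y ∈ Y
  head_eq : L.head? = L'.head?
  head_right : Y.head? = some y
  closed_right : Y.head? = Y.getLast?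
  closed_iff : L.head? = L.getLast? ↔ L'.head? = L'.getLast?
  length_eq : L.length = L'.length + Y.length + 1

/-- Since `Y` starts and ends at `y`, the only new steps are `x → y` and `y → x`, both along the
same edge. -/
lemma isInsertion_of_disjoint {P Q Y : List α} {x y : α}
    (hd : Disjoint (P ++ x :: Q).toFinset Y.toFinset) (hy : Y.head? = some y)
    (hc : Y.head? = Y.getLast?) :
    IsInsertion (P ++ x :: (Y ++ x :: Q)) (P ++ x :: Q) Y x y where
  perm := by
    have hY : Y ≠ [] := by rintro rfl; simp at hy
    have h1 : Y.head hY = y := by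
      rw [List.head?_eq_some_head hY] at hy
      exact Option.some_inj.1 hy
    have h2 : Y.getLast hY = y := by
      rw [hy, List.getLast?_eq_getLast_of_ne_nil hY] at hc
      exact (Option.some_inj.1 hc).symm
    rw [pairs_append_cons, pairs_append_cons P Q]
    have h3 : pairs (x :: (Y ++ x :: Q)) = s(x, y) :: (pairs Y ++ s(x, y) :: pairs (x :: Q)) := by
      have := pairs_append [x] (Y ++ x :: Q) (by simp) (by simp)
      rw [pairs_append Y (x :: Q) hY (by simp)] at this
      simpa [List.head_append, hY, h1, h2, Sym2.eq_swap (a := y)] using this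
    rw [h3, List.perm_iff_count]
    intro e
    simp only [List.count_append, List.count_cons]
    ring
  toFinset_eq := by ext; simp; tauto
  disj := hd
  left_mem := by simp
  right_mem := List.mem_of_mem_head? hy
  head_eq := by cases P <;> simp
  head_right := hy
  closed_right := hc
  closed_iff := by cases P <;> simp [List.getLast?_cons, List.getLast?_append]
  length_eq := by simp; omega

namespace IsInsertion

variable {L L' Y : List α} {x y : α} (h : IsInsertion L L' Y x y)

include h

lemma notMem_of_left {a : α} (ha : a ∈ L') : a ∉ Y := fun h' =>
  Finset.disjoint_left.1 h.disj (List.mem_toFinset.2 ha) (List.mem_toFinset.2 h')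

lemma mem_iff {a : α} : a ∈ L ↔ a ∈ L' ∨ a ∈ Y := by
  rw [← List.mem_toFinset, h.toFinset_eq]
  simp

lemma mem_pairs {e : Sym2 α} : e ∈ pairs L ↔ e = s(x, y) ∨ e ∈ pairs Y ∨ e ∈ pairs L' := by
  rw [h.perm.mem_iff]
  simp

lemma edge_notMem_left : s(x, y) ∉ pairs L' := fun h' =>
  h.notMem_of_left (mem_of_mem_pairs h' (Sym2.mem_mk_right _ _)) h.right_mem

lemma edge_notMem_right : s(x, y) ∉ pairs Y := fun h' =>
  h.notMem_of_left h.left_mem (mem_of_mem_pairs h' (Sym2.mem_mk_left _ _))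

lemma notMem_right_of_left {e : Sym2 α} (he : e ∈ pairs L') : e ∉ pairs Y := fun h' => by
  induction e with
  | _ a b =>
    exact h.notMem_of_left (mem_of_mem_pairs he (Sym2.mem_mk_left _ _))
      (mem_of_mem_pairs h' (Sym2.mem_mk_left _ _))

lemma count_eq (e : Sym2 α) : (pairs L).count e =
    (pairs L').count e + (pairs Y).count e + if e = s(x, y) then 2 else 0 := by
  rw [h.perm.count_eq]
  simp only [List.count_cons, List.count_append, beq_iff_eq]
  by_cases he : e = s(x, y)
  · simp [he]; ring
  · simp [he, Ne.symm he]; ring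

lemma count_left {e : Sym2 α} (he : e ∈ pairs L') : (pairs L).count e = (pairs L').count e := by
  rw [h.count_eq, List.count_eq_zero_of_not_mem (h.notMem_right_of_left he), if_neg]
  · simp
  · rintro rfl
    exact h.edge_notMem_left he

lemma count_right {e : Sym2 α} (he : e ∈ pairs Y) : (pairs L).count e = (pairs Y).count e := by
  rw [h.count_eq, List.count_eq_zero_of_not_mem (fun h' => h.notMem_right_of_left h' he), if_neg]
  · simp
  · rintro rfl
    exact h.edge_notMem_right he

lemma count_edge : (pairs L).count s(x, y) = 2 := by
  rw [h.count_eq, List.count_eq_zero_of_not_mem h.edge_notMem_left,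
    List.count_eq_zero_of_not_mem h.edge_notMem_right]
  simp

lemma toFinset_pairs :
    (pairs L).toFinset = insert s(x, y) ((pairs L').toFinset ∪ (pairs Y).toFinset) := by
  ext e
  simp only [List.mem_toFinset, h.mem_pairs, Finset.mem_insert, Finset.mem_union]
  tauto

lemma disjoint_pairs : Disjoint (pairs L').toFinset (pairs Y).toFinset :=
  Finset.disjoint_left.2 fun _ he he' =>
    h.notMem_right_of_left (List.mem_toFinset.1 he) (List.mem_toFinset.1 he')

/-- The vertex sets are disjoint and the edge sets are joined by one more edge, so the deficits
`edges + 1 - vertices` of `L'` and `Y` add up to that of `L`. Both are nonnegative by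
`card_toFinset_le`, hence the sum vanishes only if both do. -/
lemma isTreeList_iff : IsTreeList L ↔ IsTreeList L' ∧ IsTreeList Y := by
  have h1 : (pairs L).toFinset.card = (pairs L').toFinset.card + (pairs Y).toFinset.card + 1 := by
    rw [h.toFinset_pairs, Finset.card_insert_of_notMem, Finset.card_union_of_disjoint
      h.disjoint_pairs]
    simp [h.edge_notMem_left, h.edge_notMem_right]
  have h2 : L.toFinset.card = L'.toFinset.card + Y.toFinset.card := by
    rw [h.toFinset_eq, Finset.card_union_of_disjoint h.disj]
  have h3 := card_toFinset_le L'
  have h4 := card_toFinset_le Y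
  have hxy : x ≠ y := by
    rintro rfl
    exact h.notMem_of_left h.left_mem h.right_mem
  have h5 : (∀ e ∈ pairs L, ¬ e.IsDiag) ↔
      (∀ e ∈ pairs L', ¬ e.IsDiag) ∧ ∀ e ∈ pairs Y, ¬ e.IsDiag := by
    simp only [h.mem_pairs]
    constructor
    · exact fun H => ⟨fun e he => H e (by tauto), fun e he => H e (by tauto)⟩
    · rintro ⟨H1, H2⟩ e (rfl | he | he)
      · simpa using hxy
      · exact H2 e he
      · exact H1 e he
  simp only [IsTreeList, h5, h.closed_iff]
  have := h.closed_right
  constructor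
  · rintro ⟨⟨ha, hb⟩, hc, hd⟩
    exact ⟨⟨ha, hc, by omega⟩, ⟨hb, this, by omega⟩⟩
  · rintro ⟨⟨ha, hb, hc⟩, ⟨ha', hb', hc'⟩⟩
    exact ⟨⟨ha, ha'⟩, hb, by omega⟩

lemma star_left {a : α} (ha : a ∈ L') (hax : a ≠ x) : star L a = star L' a := by
  ext e
  simp only [mem_star, h.mem_pairs]
  have h1 : a ≠ y := by rintro rfl; exact h.notMem_of_left ha h.right_mem
  have h2 : e ∈ pairs Y → a ∉ e := fun he hae => h.notMem_of_left ha (mem_of_mem_pairs he hae)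
  constructor
  · rintro ⟨rfl | he | he, hae⟩
    · simp [hax, h1] at hae
    · exact absurd hae (h2 he)
    · exact ⟨he, hae⟩
  · tauto

lemma star_right {a : α} (ha : a ∈ Y) (hay : a ≠ y) : star L a = star Y a := by
  ext e
  simp only [mem_star, h.mem_pairs]
  have h1 : a ≠ x := by rintro rfl; exact h.notMem_of_left h.left_mem ha
  have h2 : e ∈ pairs L' → a ∉ e := fun he hae => h.notMem_of_left (mem_of_mem_pairs he hae) ha
  constructor
  · rintro ⟨rfl | he | he, hae⟩
    · simp [hay, h1] at hae
    · exact ⟨he, hae⟩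
    · exact absurd hae (h2 he)
  · tauto

lemma star_left_self : star L x = insert s(x, y) (star L' x) := by
  ext e
  simp only [mem_star, h.mem_pairs, Finset.mem_insert]
  have h2 : e ∈ pairs Y → x ∉ e := fun he hae =>
    h.notMem_of_left h.left_mem (mem_of_mem_pairs he hae)
  constructor
  · rintro ⟨rfl | he | he, hae⟩ <;> tauto
  · rintro (rfl | he)
    · simp
    · tauto

lemma star_right_self : star L y = insert s(x, y) (star Y y) := by
  ext e
  simp only [mem_star, h.mem_pairs, Finset.mem_insert]
  have h2 : e ∈ pairs L' → y ∉ e := fun he hae =>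
    h.notMem_of_left (mem_of_mem_pairs he hae) h.right_mem
  constructor
  · rintro ⟨rfl | he | he, hae⟩ <;> tauto
  · rintro (rfl | he)
    · simp
    · tauto

lemma thick_left {a : α} (ha : a ∈ L') (hax : a ≠ x) : Thick L a ↔ Thick L' a := by
  simp only [Thick, h.star_left ha hax]
  exact exists_congr fun e => and_congr_right fun he => by rw [h.count_left (mem_star.1 he).1]

lemma thick_right {a : α} (ha : a ∈ Y) (hay : a ≠ y) : Thick L a ↔ Thick Y a := by
  simp only [Thick, h.star_right ha hay]
  exact exists_congr fun e => and_congr_right fun he => by rw [h.count_right (mem_star.1 he).1]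

lemma thick_right_self : Thick L y ↔ Thick Y y := by
  simp only [Thick, h.star_right_self, Finset.mem_insert, or_and_right, exists_or, exists_eq_left,
    h.count_edge, ne_eq, not_true_eq_false, false_or]
  exact exists_congr fun e => and_congr_right fun he => by rw [h.count_right (mem_star.1 he).1]

lemma card_star_right_self : (star L y).card = (star Y y).card + 1 := by
  rw [h.star_right_self, Finset.card_insert_of_notMem]
  exact fun h' => h.edge_notMem_right (mem_star.1 h').1

lemma card_star_left_self : (star L x).card = (star L' x).card + 1 := by
  rw [h.star_left_self, Finset.card_insert_of_notMem]
  exact fun h' => h.edge_notMem_left (mem_star.1 h').1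

lemma card_star_pos_iff : 0 < (star Y y).card ↔ 2 ≤ Y.length := by
  have hy := h.head_right
  rw [Finset.card_pos]
  cases hY : Y with
  | nil => simp [hY] at hy
  | cons a l =>
    have : a = y := by simpa [hY] using hy
    cases l with
    | nil => simp [star]
    | cons b l =>
      simp only [List.length_cons, Nat.le_add_left, iff_true]
      exact ⟨s(a, b), by simp [mem_star, this]⟩

/-- Away from `x` and `y` the edges and their multiplicities do not change. At `x` the condition is
void on both sides, as `x` is the root or already thick. At `y` the new edge is simple and raises
the degree by one, so the condition for degrees 1 and 2 in `L` becomes one for degrees 0 and 1 in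
`Y`: degree 0 is never thick and must be excluded, which means that `Y` has positive length, and
degree 1 is the kernel condition at the root of `Y`. -/
lemma isRootedKernel_iff (hx : L'.head? = some x ∨ Thick L' x) :
    IsRootedKernel L ↔ IsRootedKernel L' ∧ IsKernelList Y ∧ 2 ≤ Y.length := by
  have hyr : L'.head? ≠ some y := fun h' => h.notMem_of_left (List.mem_of_mem_head? h') h.right_mem
  have hbr : ∀ b ∈ Y, L'.head? ≠ some b := fun b hb h' =>
    h.notMem_of_left (List.mem_of_mem_head? h') hb
  have hthick : Thick L' x → Thick L x := by
    rintro ⟨e, he, hc⟩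
    exact ⟨e, by rw [h.star_left_self]; exact Finset.mem_insert_of_mem he,
      by rwa [h.count_left (mem_star.1 he).1]⟩
  rw [IsKernelList, IsRootedKernel, IsRootedKernel, IsRootedKernel, h.isTreeList_iff, h.head_eq,
    h.head_right, ← h.card_star_pos_iff]
  constructor
  · rintro ⟨⟨h1, h2⟩, H⟩
    have hy := H y (h.mem_iff.2 (Or.inr h.right_mem)) hyr
    rw [h.thick_right_self, h.card_star_right_self] at hy
    refine ⟨⟨h1, fun a ha har hs => ?_⟩, ⟨⟨h2, fun b hb hbr' hs => ?_⟩, fun b hb hby hs => ?_⟩, ?_⟩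
    · by_cases hax : a = x
      · subst hax
        exact hx.resolve_left har
      · have := H a (h.mem_iff.2 (Or.inl ha)) har
        rw [h.thick_left ha hax, h.star_left ha hax] at this
        exact this hs
    · have hby : b ≠ y := by rintro rfl; exact hbr' rfl
      have := H b (h.mem_iff.2 (Or.inr hb)) (hbr b hb)
      rw [h.thick_right hb hby, h.star_right hb hby] at this
      exact this hs
    · obtain rfl : y = b := by simpa using hby
      exact hy (by omega)
    · by_contra hs
      obtain ⟨e, he, -⟩ := hy (by omega)
      exact hs (Finset.card_pos.2 ⟨e, he⟩)
  · rintro ⟨⟨h1, H1⟩, ⟨⟨h2, H2⟩, H3⟩, H4⟩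
    refine ⟨⟨h1, h2⟩, fun a ha har hs => ?_⟩
    rcases h.mem_iff.1 ha with ha | ha
    · by_cases hax : a = x
      · subst hax
        exact hthick (hx.resolve_left har)
      · rw [h.thick_left ha hax]
        rw [h.star_left ha hax] at hs
        exact H1 a ha har hs
    · by_cases hay : a = y
      · subst hay
        rw [h.thick_right_self]
        rw [h.card_star_right_self] at hs
        exact H3 a ha rfl (by omega)
      · rw [h.thick_right ha hay]
        rw [h.star_right ha hay] at hs
        exact H2 a ha (by simpa using Ne.symm hay) hs

lemma card_simpleEdges :
    (simpleEdges L).card = (simpleEdges L').card + (simpleEdges Y).card + 1 := by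
  have : simpleEdges L = insert s(x, y) (simpleEdges L' ∪ simpleEdges Y) := by
    ext e
    simp only [simpleEdges, Finset.mem_filter, List.mem_toFinset, Finset.mem_insert,
      Finset.mem_union, h.mem_pairs]
    constructor
    · rintro ⟨rfl | he | he, hc⟩
      · exact Or.inl rfl
      · rw [h.count_right he] at hc; tauto
      · rw [h.count_left he] at hc; tauto
    · rintro (rfl | ⟨he, hc⟩ | ⟨he, hc⟩)
      · exact ⟨Or.inl rfl, h.count_edge⟩
      · rw [h.count_left he]; tauto
      · rw [h.count_right he]; tauto
  rw [this, Finset.card_insert_of_notMem, Finset.card_union_of_disjoint]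
  · exact h.disjoint_pairs.mono (Finset.filter_subset _ _) (Finset.filter_subset _ _)
  · simp [simpleEdges, h.edge_notMem_left, h.edge_notMem_right]

end IsInsertion

/-- Insert the walk `Y` as an excursion at position `p` of the walk `L`. -/
def insertWalk (p : ℕ) (L Y : List α) : List α := L.take (p + 1) ++ (Y ++ L.drop p)

lemma insertWalk_append (P Q Y : List α) (x : α) :
    insertWalk P.length (P ++ x :: Q) Y = P ++ x :: (Y ++ x :: Q) := by
  simp [insertWalk, List.take_append]

lemma exists_append_cons {L : List α} {p : ℕ} (h : p < L.length) :
    ∃ P x Q, L = P ++ x :: Q ∧ P.length = p :=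
  ⟨L.take p, L[p], L.drop (p + 1), by simp, by simp; omega⟩

/-- The rooted kernel walks whose first simple edge is the one after the first `p` edges. -/
def IsRootedKernelAt (p : ℕ) (L : List α) : Prop :=
  IsRootedKernelFrom p L ∧ ∃ e, (pairs L)[p]? = some e ∧ (pairs L).count e = 2

/-- The kernel walks of positive length. -/
def IsProperKernelList (L : List α) : Prop := IsKernelList L ∧ 2 ≤ L.length

lemma isInsertion_insertWalk {p : ℕ} {L' Y : List α} (hp : p < L'.length)
    (hd : Disjoint L'.toFinset Y.toFinset) (hY : IsTreeList Y) :
    ∃ x y, IsInsertion (insertWalk p L' Y) L' Y x y := by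
  obtain ⟨P, x, Q, rfl, rfl⟩ := exists_append_cons hp
  rw [insertWalk_append]
  exact ⟨x, Y.head hY.ne_nil,
    isInsertion_of_disjoint hd (List.head?_eq_some_head hY.ne_nil) hY.2.1⟩

/-- Unless the prefix is empty, its last edge leads to `x` and is not simple. -/
lemma thick_of_prefix {P Q : List α} {x : α}
    (h : ∀ e ∈ pairs (P ++ [x]), (pairs (P ++ x :: Q)).count e ≠ 2) :
    (P ++ x :: Q).head? = some x ∨ Thick (P ++ x :: Q) x := by
  by_cases hP : P = []
  · left; simp [hP]
  · right
    have he : s(P.getLast hP, x) ∈ pairs (P ++ [x]) := by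
      rw [pairs_append P [x] hP (by simp)]; simp
    exact ⟨s(P.getLast hP, x), by simp [mem_star, pairs_append_cons P Q, he], h _ he⟩

lemma isRootedKernelAt_insertWalk {p : ℕ} {L' Y : List α} (hL : IsRootedKernelFrom p L')
    (hY : IsProperKernelList Y) (hd : Disjoint L'.toFinset Y.toFinset) :
    IsRootedKernelAt p (insertWalk p L' Y) := by
  obtain ⟨P, x, Q, rfl, rfl⟩ := exists_append_cons hL.2.1
  have hY' := hY.1.1.1
  have hins := isInsertion_of_disjoint hd (List.head?_eq_some_head hY'.ne_nil) hY'.2.1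
  have h3 := hL.2.2
  rw [insertWalk_append]
  rw [take_pairs] at h3
  refine ⟨⟨?_, by simp, ?_⟩, s(x, Y.head hY'.ne_nil), ?_, hins.count_edge⟩
  · rw [hins.isRootedKernel_iff (thick_of_prefix h3)]
    exact ⟨hL.1, hY⟩
  · rw [take_pairs]
    intro e he
    rw [hins.count_left (by rw [pairs_append_cons]; simp [he])]
    exact h3 e he
  · have hl : (pairs (P ++ [x])).length = P.length := by simp [length_pairs]
    rw [pairs_append_cons, List.getElem?_append_right hl.le, hl]
    obtain ⟨y, l, rfl⟩ := List.exists_cons_of_ne_nil hY'.ne_nil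
    simp

/-- The excursion lies between the two crossings of the first simple edge; the colouring of the two
sides of this edge shows that it is closed and disjoint from the rest. -/
lemma exists_insertWalk_eq {p : ℕ} {L : List α} (hL : IsRootedKernelAt p L) :
    ∃ L' Y, IsRootedKernelFrom p L' ∧ IsProperKernelList Y ∧ Disjoint L'.toFinset Y.toFinset ∧
      insertWalk p L' Y = L := by
  obtain ⟨⟨hR, hp, h3⟩, e, he, hcount⟩ := hL
  obtain ⟨P, x, R, rfl, rfl⟩ := exists_append_cons hp
  have hl : (pairs (P ++ [x])).length = P.length := by simp [length_pairs]
  rw [pairs_append_cons, List.getElem?_append_right hl.le, hl, Nat.sub_self] at he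
  cases R with
  | nil => simp at he
  | cons y M =>
    simp only [pairs_cons_cons, List.getElem?_cons_zero, Option.some_inj] at he
    rw [take_pairs] at h3
    subst he
    have hP : s(x, y) ∉ pairs (P ++ [x]) := fun h => h3 _ h hcount
    -- The first `p` edges are not simple, so both crossings come after them and one is left after
    -- the step `x → y`.
    have hcM : (pairs (y :: M)).count s(x, y) = 1 := by
      rw [pairs_append_cons, List.count_append, List.count_eq_zero_of_not_mem hP, pairs_cons_cons,
        List.count_cons_self] at hcount
      omega
    obtain ⟨c, hc⟩ := exists_separates hR.1.2.2 (e := s(x, y)) (by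
      rw [pairs_append_cons]; simp)
    have hsub : ∀ f ∈ pairs (y :: M), f ∈ pairs (P ++ x :: y :: M) := fun f hf => by
      rw [pairs_append_cons]; simp [hf]
    obtain ⟨Y, B, hY, hB, hYB, heq, hnY⟩ := exists_split_of_mem_pairs
      (List.count_pos_iff.1 (by omega : 0 < (pairs (y :: M)).count s(x, y)))
    have hpYB := pairs_append Y B hY hB
    rw [← heq, ← hYB] at hpYB
    have hnB : s(x, y) ∉ pairs B := by
      rw [hpYB, List.count_append, List.count_cons_self] at hcM
      exact List.count_eq_zero.1 (by omega)
    have hYhead : Y.head? = some y := by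
      obtain ⟨z, Y', rfl⟩ := List.exists_cons_of_ne_nil hY
      simp only [List.cons_append, List.cons.injEq] at hYB
      simp [hYB.1]
    have hcY : Separates Y s(x, y) c := fun a b hab => hc a b (hsub _ (by rw [hpYB]; simp [hab]))
    have hcB : Separates B s(x, y) c := fun a b hab => hc a b (hsub _ (by rw [hpYB]; simp [hab]))
    have hcP : Separates (P ++ [x]) s(x, y) c := fun a b hab =>
      hc a b (by rw [pairs_append_cons]; simp [hab])
    have hxy : c x ≠ c y := (hc x y (by rw [pairs_append_cons]; simp)).2 rfl
    have hYc : ∀ a ∈ Y, c a = c y := fun a ha =>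
      hcY.eq_of_notMem hnY ha (List.mem_of_mem_head? hYhead)
    have hlast := hYc _ (List.getLast_mem hY)
    rw [Sym2.eq_iff] at heq
    -- The second crossing goes from `y` to `x`: until then the walk stays on the side of `y`, so it
    -- cannot start at `x`.
    obtain ⟨h1, h2⟩ : x = B.head hB ∧ y = Y.getLast hY := by
      rcases heq with ⟨h1, -⟩ | h
      · exact absurd (by rw [h1, hlast]) hxy
      · exact h
    obtain ⟨z, Q, rfl⟩ := List.exists_cons_of_ne_nil hB
    obtain rfl : x = z := h1
    have hBc : ∀ a ∈ x :: Q, c a = c x := fun a ha => hcB.eq_of_notMem hnB ha (by simp)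
    have hPc : ∀ a ∈ P ++ [x], c a = c x := fun a ha => hcP.eq_of_notMem hP ha (by simp)
    have hd : Disjoint (P ++ x :: Q).toFinset Y.toFinset := by
      rw [Finset.disjoint_left]
      intro a ha hb
      simp only [List.mem_toFinset, List.mem_append] at ha hb
      refine hxy ?_
      rw [← hYc a hb]
      rcases ha with ha | ha
      · exact (hPc a (by simp [ha])).symm
      · exact (hBc a ha).symm
    have hclosed : Y.head? = Y.getLast? := by
      rw [hYhead, List.getLast?_eq_getLast_of_ne_nil hY, ← h2]
    have hins := isInsertion_of_disjoint hd hYhead hclosed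
    rw [hYB] at hR h3
    have h3' : ∀ e ∈ pairs (P ++ [x]), (pairs (P ++ x :: Q)).count e ≠ 2 := fun e he => by
      rw [← hins.count_left (by rw [pairs_append_cons]; simp [he])]
      exact h3 e he
    obtain ⟨hr1, hr2⟩ := (hins.isRootedKernel_iff (thick_of_prefix h3')).1 hR
    exact ⟨P ++ x :: Q, Y, ⟨hr1, by simp, by rwa [take_pairs]⟩, hr2, hd, by
      rw [insertWalk_append, hYB]⟩

/-- The vertex `x` at position `p` is not in `Y`, so `Y` ends right before the next occurrence of
`x`. -/
lemma insertWalk_injective {p : ℕ} {L₁ L₂ Y₁ Y₂ : List α} (h₁ : p < L₁.length) (h₂ : p < L₂.length)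
    (hd₁ : Disjoint L₁.toFinset Y₁.toFinset) (hd₂ : Disjoint L₂.toFinset Y₂.toFinset)
    (h : insertWalk p L₁ Y₁ = insertWalk p L₂ Y₂) : L₁ = L₂ ∧ Y₁ = Y₂ := by
  obtain ⟨P₁, x, Q₁, rfl, hp₁⟩ := exists_append_cons h₁
  obtain ⟨P₂, z, Q₂, rfl, rfl⟩ := exists_append_cons h₂
  rw [← hp₁, insertWalk_append, hp₁, insertWalk_append] at h
  obtain ⟨rfl, h'⟩ := List.append_inj h hp₁
  simp only [List.cons.injEq] at h'
  obtain ⟨rfl, h'⟩ := h'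
  have hx : ∀ {Q Y : List α}, Disjoint (P₁ ++ x :: Q).toFinset Y.toFinset → x ∉ Y := fun hd hx =>
    Finset.disjoint_left.1 hd (List.mem_toFinset.2 (by simp)) (List.mem_toFinset.2 hx)
  have key : ∀ {Q₁ Q₂ Y₁ Y₂ : List α}, x ∉ Y₁ → x ∉ Y₂ → Y₁ ++ x :: Q₁ = Y₂ ++ x :: Q₂ →
      Y₁ = Y₂ ∧ Q₁ = Q₂ := by
    intro Q₁ Q₂ Y₁
    induction Y₁ with
    | nil =>
      intro Y₂ _ h2 h
      cases Y₂ with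
      | nil => simpa using h
      | cons b Y₂ =>
        simp only [List.nil_append, List.cons_append, List.cons.injEq] at h
        simp [h.1] at h2
    | cons a Y₁ ih =>
      intro Y₂ h1 h2 h
      cases Y₂ with
      | nil =>
        simp only [List.nil_append, List.cons_append, List.cons.injEq] at h
        simp [h.1] at h1
      | cons b Y₂ =>
        simp only [List.cons_append, List.cons.injEq, List.mem_cons, not_or] at h h1 h2
        have := ih h1.2 h2.2 h.2
        simp [h.1, this.1, this.2]
  obtain ⟨rfl, rfl⟩ := key (hx hd₁) (hx hd₂) h'
  exact ⟨rfl, rfl⟩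

end Insertion

/-! ### Statistics of walks, the case of a simple leaf at the root, and the case distinction at the
next edge. -/

section Statistics

set_option linter.unusedSectionVars false

variable {α : Type*} [DecidableEq α]

/-- The number of simple edges, the number of vertices and half the length of a closed walk. -/
noncomputable def stat (L : List α) : Fin 3 →₀ ℕ :=
  Finsupp.equivFunOnFinite.symm ![(simpleEdges L).card, L.toFinset.card, L.length / 2]

@[simp] lemma stat_zero (L : List α) : stat L 0 = (simpleEdges L).card := rfl
@[simp] lemma stat_one (L : List α) : stat L 1 = L.toFinset.card := rfl
@[simp] lemma stat_two (L : List α) : stat L 2 = L.length / 2 := rfl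

lemma IsTreeList.exists_length {L : List α} (h : IsTreeList L) : ∃ k, L.length = 2 * k + 1 := by
  obtain ⟨k, hk⟩ := h.even_length_pairs
  have := List.length_pos_iff.2 h.ne_nil
  rw [length_pairs] at hk
  exact ⟨k, by omega⟩

lemma IsTreeList.length_eq {L : List α} (h : IsTreeList L) : L.length = 2 * stat L 2 + 1 := by
  obtain ⟨k, hk⟩ := h.exists_length
  rw [stat_two]
  omega

lemma IsInsertion.stat_eq {L L' Y : List α} {x y : α} (h : IsInsertion L L' Y x y)
    (hL' : IsTreeList L') (hY : IsTreeList Y) :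
    stat L = (Finsupp.single 0 1 + Finsupp.single 2 1) + (stat L' + stat Y) := by
  obtain ⟨k, hk⟩ := hL'.exists_length
  obtain ⟨l, hl⟩ := hY.exists_length
  ext i
  fin_cases i
  · simp [h.card_simpleEdges]; ring
  · simp [h.toFinset_eq, Finset.card_union_of_disjoint h.disj]
  · simp [h.length_eq]; omega

lemma IsSuperreducedList.simpleEdges_eq {L : List α} (h : IsSuperreducedList L) :
    simpleEdges L = ∅ := by
  rw [simpleEdges, Finset.filter_eq_empty_iff]
  exact fun e he => h.2 e (List.mem_toFinset.1 he)

lemma IsSuperreducedList.thick {L : List α} (h : IsSuperreducedList L) {x : α}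
    (hx : 0 < (star L x).card) : Thick L x := by
  obtain ⟨e, he⟩ := Finset.card_pos.1 hx
  exact ⟨e, he, h.2 e (mem_star.1 he).1⟩

lemma IsSuperreducedList.isKernelList {L : List α} (h : IsSuperreducedList L) : IsKernelList L :=
  ⟨⟨h.1, fun _ _ _ hs => h.thick (by omega)⟩, fun _ _ _ hs => h.thick (by omega)⟩

/-- A rooted kernel walk whose root is a leaf incident to a simple edge is an excursion inserted
into the walk of length `0`. -/
lemma exists_insertWalk_singleton_eq {L : List α} (h : IsRootedKernel L) (hK : ¬ IsKernelList L) :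
    ∃ r Y, IsProperKernelList Y ∧ Disjoint [r].toFinset Y.toFinset ∧ insertWalk 0 [r] Y = L := by
  have : ∃ x ∈ L, L.head? = some x ∧ (star L x).card = 1 ∧ ¬ Thick L x := by
    by_contra! H
    exact hK ⟨h, H⟩
  obtain ⟨r, hr, hhead, hcard, hthin⟩ := this
  have hthin' : ∀ e ∈ star L r, (pairs L).count e = 2 := by
    simpa [Thick] using hthin
  -- The only edge at the root is simple and is the first one traversed, so the decomposition
  -- applies with `p = 0`.
  have hAt : IsRootedKernelAt 0 L := by
    refine ⟨⟨h, List.length_pos_of_mem hr, by simp⟩, ?_⟩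
    cases L with
    | nil => simp at hr
    | cons a l =>
      obtain rfl : a = r := by simpa using hhead
      cases l with
      | nil => simp [star] at hcard
      | cons b l => exact ⟨s(a, b), by simp, hthin' _ (by simp [mem_star])⟩
  obtain ⟨L', Y, hL', hY, hd, rfl⟩ := exists_insertWalk_eq hAt
  obtain ⟨P, x, Q, rfl, hP⟩ := exists_append_cons hL'.2.1
  obtain rfl := List.length_eq_zero_iff.1 hP
  have hY' := hY.1.1.1
  have hins := isInsertion_of_disjoint hd (List.head?_eq_some_head hY'.ne_nil) hY'.2.1
  have heq := insertWalk_append [] Q Y x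
  simp only [List.length_nil, List.nil_append] at heq hins hhead hcard
  rw [heq] at hhead hcard
  obtain rfl : x = r := by simpa using hhead
  rw [hins.card_star_left_self] at hcard
  -- If the remaining walk had positive length, the root would have a second edge.
  cases Q with
  | nil => exact ⟨x, Y, hY, hd, rfl⟩
  | cons b Q =>
    have : 0 < (star (x :: b :: Q) x).card := Finset.card_pos.2 ⟨s(x, b), by simp [mem_star]⟩
    omega

lemma isRootedKernelFrom_singleton (r : α) : IsRootedKernelFrom 0 [r] := by
  refine ⟨⟨⟨by simp, by simp, by simp⟩, ?_⟩, by simp, by simp⟩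
  simp

lemma isRootedKernel_insertWalk_singleton {r : α} {Y : List α} (hY : IsProperKernelList Y)
    (hd : Disjoint [r].toFinset Y.toFinset) :
    IsRootedKernel (insertWalk 0 [r] Y) ∧ ¬ IsKernelList (insertWalk 0 [r] Y) := by
  refine ⟨(isRootedKernelAt_insertWalk (isRootedKernelFrom_singleton r) hY hd).1.1, fun hK => ?_⟩
  have hY' := hY.1.1.1
  have hins := isInsertion_of_disjoint (P := []) (Q := []) hd
    (List.head?_eq_some_head hY'.ne_nil) hY'.2.1
  have heq := insertWalk_append [] [] Y r
  simp only [List.length_nil, List.nil_append] at heq hins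
  rw [heq] at hK
  have hs : star [r] r = ∅ := rfl
  obtain ⟨e, he, hc⟩ := hK.2 r (by simp) (by simp) (by rw [hins.card_star_left_self, hs]; rfl)
  rw [hins.star_left_self, hs, Finset.mem_insert] at he
  obtain rfl := he.resolve_right (by simp)
  exact hc hins.count_edge

/-! ### Invariance under injective relabelling. -/

section Map

variable {β : Type*} [DecidableEq β] {f : α → β} (hf : Function.Injective f) (L : List α)

include hf

lemma count_pairs_map (e : Sym2 α) :
    (pairs (L.map f)).count (Sym2.map f e) = (pairs L).count e := by
  rw [pairs_map, List.count_map_of_injective _ _ (Sym2.map.injective hf)]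

lemma toFinset_pairs_map :
    (pairs (L.map f)).toFinset = (pairs L).toFinset.image (Sym2.map f) := by
  ext; simp [pairs_map]

lemma card_toFinset_map : (L.map f).toFinset.card = L.toFinset.card := by
  have : (L.map f).toFinset = L.toFinset.image f := by ext; simp
  rw [this, Finset.card_image_of_injective _ hf]

lemma isTreeList_map : IsTreeList (L.map f) ↔ IsTreeList L := by
  rw [IsTreeList, IsTreeList, card_toFinset_map hf, toFinset_pairs_map hf,
    Finset.card_image_of_injective _ (Sym2.map.injective hf), pairs_map, List.forall_mem_map,
    List.head?_map, List.getLast?_map, (Option.map_injective hf).eq_iff]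
  simp only [Sym2.isDiag_map hf]

lemma star_map (x : α) : star (L.map f) (f x) = (star L x).image (Sym2.map f) := by
  ext e
  simp only [mem_star, pairs_map, List.mem_map, Finset.mem_image]
  constructor
  · rintro ⟨⟨e, he, rfl⟩, hx⟩
    obtain ⟨y, hy, hyx⟩ := Sym2.mem_map.1 hx
    exact ⟨e, ⟨he, hf hyx ▸ hy⟩, rfl⟩
  · rintro ⟨e, ⟨he, hx⟩, rfl⟩
    exact ⟨⟨e, he, rfl⟩, Sym2.mem_map.2 ⟨x, hx, rfl⟩⟩

lemma card_star_map (x : α) : (star (L.map f) (f x)).card = (star L x).card := by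
  rw [star_map hf, Finset.card_image_of_injective _ (Sym2.map.injective hf)]

lemma thick_map (x : α) : Thick (L.map f) (f x) ↔ Thick L x := by
  simp only [Thick, star_map hf, Finset.mem_image, exists_exists_and_eq_and, count_pairs_map hf]

lemma isRootedKernel_map : IsRootedKernel (L.map f) ↔ IsRootedKernel L := by
  simp only [IsRootedKernel, isTreeList_map hf, List.forall_mem_map, card_star_map hf,
    thick_map hf, List.head?_map, Option.map_eq_some_iff, hf.eq_iff, exists_eq_right, ne_eq]

lemma isKernelList_map : IsKernelList (L.map f) ↔ IsKernelList L := by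
  simp only [IsKernelList, isRootedKernel_map hf, List.forall_mem_map, card_star_map hf,
    thick_map hf, List.head?_map, Option.map_eq_some_iff, hf.eq_iff, exists_eq_right]

lemma isSuperreducedList_map : IsSuperreducedList (L.map f) ↔ IsSuperreducedList L := by
  rw [IsSuperreducedList, isTreeList_map hf, pairs_map, List.forall_mem_map, ← pairs_map]
  simp only [count_pairs_map hf, IsSuperreducedList]

lemma isRootedKernelFrom_map (p : ℕ) :
    IsRootedKernelFrom p (L.map f) ↔ IsRootedKernelFrom p L := by
  rw [IsRootedKernelFrom, isRootedKernel_map hf, List.length_map, pairs_map, ← List.map_take,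
    List.forall_mem_map, ← pairs_map]
  simp only [count_pairs_map hf, IsRootedKernelFrom]

lemma isRootedKernelAt_map (p : ℕ) : IsRootedKernelAt p (L.map f) ↔ IsRootedKernelAt p L := by
  rw [IsRootedKernelAt, isRootedKernelFrom_map hf, pairs_map, List.getElem?_map, ← pairs_map]
  simp only [Option.map_eq_some_iff, exists_exists_and_eq_and, count_pairs_map hf,
    IsRootedKernelAt]

lemma stat_map : stat (L.map f) = stat L := by
  ext i
  fin_cases i
  · have : simpleEdges (L.map f) = (simpleEdges L).image (Sym2.map f) := by
      rw [simpleEdges, toFinset_pairs_map hf, Finset.filter_image]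
      simp only [count_pairs_map hf, simpleEdges]
    simp [this, Finset.card_image_of_injective _ (Sym2.map.injective hf)]
  · simp only [Fin.mk_one, stat_one, card_toFinset_map hf]
  · simp

end Map

/-- The three cases are that the step after the first `p` is not simple, is simple, or does not
exist. In the last case no edge is simple. -/
lemma isRootedKernelFrom_iff (p : ℕ) (L : List α) : IsRootedKernelFrom p L ↔
    IsRootedKernelFrom (p + 1) L ∨ IsRootedKernelAt p L ∨
      (IsSuperreducedList L ∧ L.length = p + 1) := by
  have hlen := length_pairs L
  constructor
  · rintro ⟨h1, h2, h3⟩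
    by_cases hp : p + 1 < L.length
    · have hp' : p < (pairs L).length := by omega
      by_cases hc : (pairs L).count (pairs L)[p] = 2
      · exact Or.inr (Or.inl ⟨⟨h1, h2, h3⟩, _, List.getElem?_eq_getElem hp', hc⟩)
      · refine Or.inl ⟨h1, hp, fun e he => ?_⟩
        rw [List.take_succ_eq_append_getElem hp', List.mem_append, List.mem_singleton] at he
        rcases he with he | rfl
        · exact h3 e he
        · exact hc
    · rw [List.take_of_length_le (by omega)] at h3
      exact Or.inr (Or.inr ⟨⟨h1.1, h3⟩, by omega⟩)
  · rintro (⟨h1, h2, h3⟩ | h | ⟨h1, h2⟩)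
    · exact ⟨h1, by omega, fun e he => h3 e (List.take_subset_take_left _ (by omega) he)⟩
    · exact h.1
    · exact ⟨h1.isKernelList.1, by omega, fun e he => h1.2 e (List.mem_of_mem_take he)⟩

lemma IsRootedKernelAt.lt {p : ℕ} {L : List α} (h : IsRootedKernelAt p L) : p + 1 < L.length := by
  obtain ⟨-, e, he, -⟩ := h
  have := (List.getElem?_eq_some_iff.1 he).1
  rw [length_pairs] at this
  omega

lemma IsRootedKernelAt.not_from {p : ℕ} {L : List α} (h : IsRootedKernelAt p L) :
    ¬ IsRootedKernelFrom (p + 1) L := by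
  obtain ⟨-, e, he, hc⟩ := h
  exact fun h' => h'.2.2 e (List.mem_of_getElem? (i := p) (by
    rw [List.getElem?_take_of_lt (by omega), he])) hc

end Statistics

/-! ### Relabelling-invariant classes and their exponential generating functions. -/

section GeneratingFunctions

/-- A class of lists of labels which is invariant under relabelling. -/
structure ListClass where
  /-- The membership predicate. -/
  pred : ∀ {α : Type} [DecidableEq α], List α → Prop
  /-- The invariance under relabelling. -/
  pred_map : ∀ {α β : Type} [DecidableEq α] [DecidableEq β] {f : α → β},
    Function.Injective f → ∀ L : List α, pred (L.map f) ↔ pred L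

namespace ListClass

/-- The lists of the class `P` with set of labels `A` and statistics `d`. -/
def lists (P : ListClass) {α : Type} [DecidableEq α] (A : Finset α) (d : Fin 3 →₀ ℕ) :
    Set (List α) :=
  {L | P.pred L ∧ L.toFinset = A ∧ stat L = d}

/-- The number of lists of the class `P` on the labels `Fin (d 1)` with statistics `d`. -/
noncomputable def count (P : ListClass) (d : Fin 3 →₀ ℕ) : ℕ :=
  (P.lists (Finset.univ : Finset (Fin (d 1))) d).ncard

/-- The generating function of a class of lists, exponential in the number of labels. -/
noncomputable def gf (P : ListClass) : MvPowerSeries (Fin 3) ℚ := fun d =>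
  (P.count d : ℚ) / (d 1).factorial

lemma coeff_gf (P : ListClass) (d : Fin 3 →₀ ℕ) :
    MvPowerSeries.coeff d P.gf = (P.count d : ℚ) / (d 1).factorial := rfl

lemma lists_finite (P : ListClass) {α : Type} [DecidableEq α] [Finite α] (A : Finset α)
    (d : Fin 3 →₀ ℕ) : (P.lists A d).Finite := by
  refine (List.finite_length_le α (2 * d 2 + 1)).subset ?_
  rintro L ⟨-, -, rfl⟩
  simp only [Set.mem_ofPred_eq, stat_two]
  omega

lemma ncard_lists_map (P : ListClass) {α β : Type} [DecidableEq α] [DecidableEq β] (f : α ↪ β)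
    (A : Finset α) (d : Fin 3 →₀ ℕ) : (P.lists (A.map f) d).ncard = (P.lists A d).ncard := by
  have : P.lists (A.map f) d = List.map f '' P.lists A d := by
    ext L
    constructor
    · rintro ⟨h1, h2, h3⟩
      have : ∃ L₀ : List α, L₀.map f = L := by
        rw [← Set.mem_range, Set.range_list_map]
        intro x hx
        have : x ∈ A.map f := by rw [← h2]; simpa using hx
        obtain ⟨a, -, rfl⟩ := Finset.mem_map.1 this
        exact ⟨a, rfl⟩
      obtain ⟨L, rfl⟩ := this
      refine ⟨L, ⟨(P.pred_map f.injective L).1 h1, ?_, by rwa [stat_map f.injective] at h3⟩, rfl⟩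
      rw [← Finset.map_inj (f := f), ← h2]
      ext; simp
    · rintro ⟨L, ⟨h1, h2, h3⟩, rfl⟩
      refine ⟨(P.pred_map f.injective L).2 h1, ?_, by rwa [stat_map f.injective]⟩
      rw [← h2]
      ext; simp
  rw [this, Set.ncard_image_of_injective _ (List.map_injective_iff.2 f.injective)]

/-- By invariance the count depends only on the size of the label set; a set of the wrong size
contradicts the statistics. -/
lemma ncard_lists (P : ListClass) {n : ℕ} (A : Finset (Fin n)) (d : Fin 3 →₀ ℕ) :
    (P.lists A d).ncard = if A.card = d 1 then P.count d else 0 := by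
  split_ifs with h
  · have : A = Finset.univ.map (A.orderEmbOfFin h).toEmbedding := by
      rw [Finset.map_orderEmbOfFin_univ]
    rw [this, ncard_lists_map, count]
  · rw [Set.ncard_eq_zero (P.lists_finite A d), Set.eq_empty_iff_forall_notMem]
    rintro L ⟨-, rfl, rfl⟩
    exact h rfl

lemma gf_add {T P Q : ListClass}
    (h : ∀ n, ∀ L : List (Fin n), T.pred L ↔ P.pred L ∨ Q.pred L)
    (h' : ∀ n, ∀ L : List (Fin n), P.pred L → ¬ Q.pred L) : T.gf = P.gf + Q.gf := by
  ext d
  rw [map_add, coeff_gf, coeff_gf, coeff_gf, ← add_div, ← Nat.cast_add, count, count, count,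
    ← Set.ncard_union_eq _ (lists_finite _ _ _) (lists_finite _ _ _)]
  · congr 3
    ext L
    simp only [lists, Set.mem_ofPred_eq, h, Set.mem_union]
    tauto
  · rw [Set.disjoint_left]
    exact fun L h1 h2 => h' _ L h1.1 h2.1

/-- The product rule for labelled structures: a `T`-structure is a pair with complementary label
sets, and the choice of these sets gives the binomial coefficient that the factorials absorb. The
shift `c` records what the operation itself adds; it adds no labels. -/
lemma gf_mul {T P Q : ListClass} (c : Fin 3 →₀ ℕ) (hc : c 1 = 0)
    (op : ∀ n, List (Fin n) → List (Fin n) → List (Fin n))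
    (h₁ : ∀ n L Y, P.pred L → Q.pred Y → Disjoint L.toFinset Y.toFinset →
      T.pred (op n L Y) ∧ (op n L Y).toFinset = L.toFinset ∪ Y.toFinset ∧
        stat (op n L Y) = c + (stat L + stat Y))
    (h₂ : ∀ n L, T.pred L → ∃ L' Y, P.pred L' ∧ Q.pred Y ∧ Disjoint L'.toFinset Y.toFinset ∧
      op n L' Y = L)
    (h₃ : ∀ n L₁ L₂ Y₁ Y₂, P.pred L₁ → P.pred L₂ → Disjoint L₁.toFinset Y₁.toFinset →
      Disjoint L₂.toFinset Y₂.toFinset → op n L₁ Y₁ = op n L₂ Y₂ → L₁ = L₂ ∧ Y₁ = Y₂) :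
    T.gf = monomial c 1 * (P.gf * Q.gf) := by
  have key : ∀ d : Fin 3 →₀ ℕ, (T.count (c + d) : ℚ) / (d 1).factorial =
      ∑ q ∈ Finset.HasAntidiagonal.antidiagonal d, (P.count q.1 : ℚ) / (q.1 1).factorial *
        ((Q.count q.2 : ℚ) / (q.2 1).factorial) := by
    intro d
    have hd : (c + d) 1 = d 1 := by simp [hc]
    rw [count]
    generalize hn : (c + d) 1 = n at *
    let S : Set (List (Fin n) × List (Fin n)) := {q | P.pred q.1 ∧ Q.pred q.2 ∧
      Disjoint q.1.toFinset q.2.toFinset ∧ q.1.toFinset ∪ q.2.toFinset = Finset.univ ∧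
      stat q.1 + stat q.2 = d}
    have hS : S.Finite := by
      refine ((List.finite_length_le (Fin n) (2 * d 2 + 1)).prod
        (List.finite_length_le (Fin n) (2 * d 2 + 1))).subset ?_
      rintro ⟨L, Y⟩ ⟨-, -, -, -, rfl⟩
      simp only [Finsupp.add_apply, stat_two, Set.mem_prod, Set.mem_ofPred_eq]
      omega
    have e1 : (T.lists (Finset.univ : Finset (Fin n)) (c + d)).ncard = S.ncard := by
      symm
      refine Set.ncard_congr (fun q _ => op n q.1 q.2) ?_ ?_ ?_
      · rintro ⟨L, Y⟩ ⟨hP, hQ, hD, hU, rfl⟩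
        obtain ⟨a1, a2, a3⟩ := h₁ n L Y hP hQ hD
        exact ⟨a1, a2.trans hU, a3⟩
      · rintro ⟨L₁, Y₁⟩ ⟨L₂, Y₂⟩ ⟨hP, hQ, hD, hU, -⟩ ⟨hP', hQ', hD', hU', -⟩ h
        obtain ⟨rfl, rfl⟩ := h₃ n L₁ L₂ Y₁ Y₂ hP hP' hD hD' h
        rfl
      · rintro L ⟨hT, hU, hs⟩
        obtain ⟨L', Y, hP, hQ, hD, rfl⟩ := h₂ n L hT
        obtain ⟨a1, a2, a3⟩ := h₁ n L' Y hP hQ hD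
        exact ⟨(L', Y), ⟨hP, hQ, hD, a2.symm.trans hU, add_left_cancel (a3.symm.trans hs)⟩, rfl⟩
    -- The pairs are sorted by both statistics and by the label set `B` of the second component.
    have e2 : S.ncard = ∑ q ∈ Finset.HasAntidiagonal.antidiagonal d, ∑ B : Finset (Fin n),
        (P.lists Bᶜ q.1).ncard * (Q.lists B q.2).ncard := by
      rw [Set.ncard_eq_toFinset_card _ hS, ← Finset.sum_product', Finset.card_eq_sum_card_fiberwise
        (f := fun q => ((stat q.1, stat q.2), q.2.toFinset))
        (t := Finset.HasAntidiagonal.antidiagonal d ×ˢ Finset.univ)]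
      · refine Finset.sum_congr rfl ?_
        rintro ⟨⟨d', d''⟩, B⟩ hq
        simp only [Finset.mem_product, Finset.HasAntidiagonal.mem_antidiagonal, Finset.mem_univ, and_true] at hq
        rw [← Set.ncard_prod, ← Set.ncard_coe_finset]
        congr 1
        ext ⟨L, Y⟩
        simp only [Finset.coe_filter, Set.Finite.mem_toFinset, Set.mem_ofPred_eq, S, Prod.mk.injEq,
          lists, Set.mem_prod]
        constructor
        · rintro ⟨⟨a1, a2, a3, a4, a5⟩, ⟨rfl, rfl⟩, rfl⟩
          refine ⟨⟨a1, ?_, rfl⟩, a2, rfl, rfl⟩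
          exact (IsCompl.of_eq a3.eq_bot a4).eq_compl
        · rintro ⟨⟨a1, a2, rfl⟩, a3, rfl, rfl⟩
          refine ⟨⟨a1, a3, ?_, ?_, hq⟩, ⟨rfl, rfl⟩, rfl⟩
          · rw [a2]; exact disjoint_compl_left
          · rw [a2]; exact compl_sup_eq_top
      · rintro ⟨L, Y⟩ hq
        have := (hS.mem_toFinset.1 hq).2.2.2.2
        simpa using this
    rw [e1, e2, Nat.cast_sum, Finset.sum_div]
    refine Finset.sum_congr rfl ?_
    rintro ⟨d', d''⟩ hq
    rw [Finset.HasAntidiagonal.mem_antidiagonal] at hq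
    have hq1 : d' 1 + d'' 1 = n := by rw [hd, ← hq]; rfl
    have e3 : ∑ B : Finset (Fin n), (P.lists Bᶜ d').ncard * (Q.lists B d'').ncard =
        n.choose (d'' 1) * (P.count d' * Q.count d'') := by
      have : ∀ B : Finset (Fin n), (P.lists Bᶜ d').ncard * (Q.lists B d'').ncard =
          if B.card = d'' 1 then P.count d' * Q.count d'' else 0 := by
        intro B
        rw [ncard_lists, ncard_lists, Finset.card_compl, Fintype.card_fin]
        have hB := Finset.card_le_univ B
        rw [Fintype.card_fin] at hB
        by_cases h : B.card = d'' 1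
        · rw [if_pos h, if_pos (by omega), if_pos h]
        · rw [if_neg h, if_neg h, mul_zero]
      simp only [this]
      rw [← Finset.sum_filter, Finset.sum_const, smul_eq_mul]
      congr 1
      have := Finset.card_powersetCard (d'' 1) (Finset.univ : Finset (Fin n))
      rw [Finset.card_univ, Fintype.card_fin] at this
      rw [← this]
      congr 1
      ext B
      simp
    simp only [e3]
    rw [← hd, ← hq1, Nat.cast_mul, Nat.add_comm, Nat.cast_add_choose]
    have f1 : ((d' 1).factorial : ℚ) ≠ 0 := by positivity
    have f2 : ((d'' 1).factorial : ℚ) ≠ 0 := by positivity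
    have f3 : ((d'' 1 + d' 1).factorial : ℚ) ≠ 0 := by positivity
    push_cast
    field_simp
  ext d
  rw [coeff_monomial_mul, coeff_gf]
  split_ifs with h
  · obtain ⟨e, rfl⟩ := exists_add_of_le h
    have hd : (c + e) 1 = e 1 := by simp [hc]
    rw [add_tsub_cancel_left, one_mul, coeff_mul, hd, key]
    rfl
  · have : T.count d = 0 := by
      rw [count, Set.ncard_eq_zero (T.lists_finite _ d), Set.eq_empty_iff_forall_notMem]
      rintro L ⟨hT, -, hs⟩
      obtain ⟨L', Y, hP, hQ, hD, rfl⟩ := h₂ _ L hT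
      obtain ⟨-, -, a3⟩ := h₁ _ L' Y hP hQ hD
      exact h (by rw [← hs, a3]; exact le_self_add)
    simp [this]

/-- The class of kernel walks. -/
def kernel : ListClass := ⟨IsKernelList, fun hf L => isKernelList_map hf L⟩

/-- The class of kernel walks of positive length. -/
def properKernel : ListClass :=
  ⟨IsProperKernelList, fun hf L => by
    rw [IsProperKernelList, isKernelList_map hf, List.length_map, IsProperKernelList]⟩

/-- The class of rooted kernel walks whose first `p` edges are not simple. -/
def rootedFrom (p : ℕ) : ListClass :=
  ⟨IsRootedKernelFrom p, fun hf L => isRootedKernelFrom_map hf L p⟩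

/-- The class of rooted kernel walks whose first simple edge is the one after the first `p`. -/
def rootedAt (p : ℕ) : ListClass :=
  ⟨IsRootedKernelAt p, fun hf L => isRootedKernelAt_map hf L p⟩

/-- The class of superreduced walks. -/
def super : ListClass := ⟨IsSuperreducedList, fun hf L => isSuperreducedList_map hf L⟩

/-- The class of superreduced walks of length `p`. -/
def superLength (p : ℕ) : ListClass :=
  ⟨fun L => IsSuperreducedList L ∧ L.length = p + 1, fun hf L => by
    rw [isSuperreducedList_map hf, List.length_map]⟩

/-- The class of walks of length `0`. -/
def singleton : ListClass := ⟨fun L => L.length = 1, fun _ L => by rw [List.length_map]⟩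

/-- The class of rooted kernel walks whose root is a leaf incident to a simple edge. -/
def rootedLeaf : ListClass :=
  ⟨fun L => IsRootedKernel L ∧ ¬ IsKernelList L, fun hf L => by
    rw [isRootedKernel_map hf, isKernelList_map hf]⟩

/-- The union of two classes. -/
def union (P Q : ListClass) : ListClass :=
  ⟨fun L => P.pred L ∨ Q.pred L, fun hf L => by rw [P.pred_map hf, Q.pred_map hf]⟩

lemma rootedFrom_eq (p : ℕ) :
    (rootedFrom p).gf = (rootedFrom (p + 1)).gf + ((rootedAt p).gf + (superLength p).gf) := by
  rw [← gf_add (T := union (rootedAt p) (superLength p)) (fun _ _ => Iff.rfl)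
    (fun n L h h' => by have := IsRootedKernelAt.lt h; have := h'.2; omega)]
  refine gf_add (fun n L => isRootedKernelFrom_iff p L) ?_
  rintro n L h (h' | h')
  · exact IsRootedKernelAt.not_from h' h
  · have := h.2.1
    have := h'.2
    omega

lemma monomial_eq : monomial (Finsupp.single 0 1 + Finsupp.single 2 1) (1 : ℚ) =
    (X 0 * X 2 : MvPowerSeries (Fin 3) ℚ) := by
  rw [X, X, monomial_mul_monomial, one_mul]

/-- The factor `u z` accounts for the new simple edge, whose two traversals raise half the length by
one. -/
lemma rootedAt_eq (p : ℕ) :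
    (rootedAt p).gf = X 0 * X 2 * ((rootedFrom p).gf * properKernel.gf) := by
  rw [← monomial_eq]
  refine gf_mul _ (by simp) (fun n => insertWalk p) ?_ ?_ ?_
  · intro n L Y hL hY hd
    obtain ⟨x, y, h⟩ := isInsertion_insertWalk hL.2.1 hd hY.1.1.1
    exact ⟨isRootedKernelAt_insertWalk hL hY hd, h.toFinset_eq, h.stat_eq hL.1.1 hY.1.1.1⟩
  · exact fun n L hL => exists_insertWalk_eq hL
  · exact fun n L₁ L₂ Y₁ Y₂ h₁ h₂ hd₁ hd₂ h => insertWalk_injective h₁.2.1 h₂.2.1 hd₁ hd₂ h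

lemma rootedLeaf_eq : rootedLeaf.gf = X 0 * X 2 * (singleton.gf * properKernel.gf) := by
  rw [← monomial_eq]
  refine gf_mul _ (by simp) (fun n => insertWalk 0) ?_ ?_ ?_
  · intro n L Y hL hY hd
    obtain ⟨r, rfl⟩ := List.length_eq_one_iff.1 hL
    obtain ⟨x, y, h⟩ := isInsertion_insertWalk (p := 0) (by simp) hd hY.1.1.1
    exact ⟨isRootedKernel_insertWalk_singleton hY hd, h.toFinset_eq,
      h.stat_eq (isRootedKernelFrom_singleton r).1.1 hY.1.1.1⟩
  · intro n L hL
    obtain ⟨r, Y, hY, hd, h⟩ := exists_insertWalk_singleton_eq hL.1 hL.2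
    exact ⟨[r], Y, rfl, hY, hd, h⟩
  · intro n L₁ L₂ Y₁ Y₂ h₁ h₂ hd₁ hd₂ h
    have h₁' : L₁.length = 1 := h₁
    have h₂' : L₂.length = 1 := h₂
    exact insertWalk_injective (by omega) (by omega) hd₁ hd₂ h

lemma rootedFrom_zero_eq : (rootedFrom 0).gf = kernel.gf + rootedLeaf.gf := by
  refine gf_add (fun n L => ?_) (fun n L h h' => h'.2 h)
  have h0 : IsRootedKernelFrom 0 L ↔ IsRootedKernel L :=
    ⟨fun h => h.1, fun h => ⟨h, List.length_pos_iff.2 h.1.ne_nil, by simp⟩⟩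
  have h1 : IsKernelList L → IsRootedKernel L := fun h => h.1
  change IsRootedKernelFrom 0 L ↔ IsKernelList L ∨ (IsRootedKernel L ∧ ¬ IsKernelList L)
  rw [h0]
  tauto

lemma kernel_eq : kernel.gf = properKernel.gf + singleton.gf := by
  refine gf_add (fun n L => ?_) (fun n L h h' => ?_)
  · change IsKernelList L ↔ IsProperKernelList L ∨ L.length = 1
    constructor
    · intro h
      have := List.length_pos_iff.2 h.1.1.ne_nil
      by_cases hL : L.length = 1
      · exact Or.inr hL
      · exact Or.inl ⟨h, by omega⟩
    · rintro (h | h)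
      · exact h.1
      · obtain ⟨r, rfl⟩ := List.length_eq_one_iff.1 h
        exact ⟨(isRootedKernelFrom_singleton r).1, by simp [star]⟩
  · have h1 : L.length = 1 := h'
    have := h.2
    omega

lemma singleton_eq : singleton.gf = X 1 := by
  have hstat : ∀ {α : Type} [DecidableEq α] (r : α), stat [r] = Finsupp.single 1 1 := by
    intro α _ r
    ext i
    fin_cases i <;> simp [simpleEdges]
  ext d
  rw [coeff_gf, coeff_X, count]
  split_ifs with h
  · subst h
    -- The number of labels is `Finsupp.single 1 1 1`, which is not literally `1`; a variable `n`
    -- allows the substitution.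
    have : ∀ n, n = 1 →
        (singleton.lists (Finset.univ : Finset (Fin n)) (Finsupp.single 1 1)).ncard = 1 := by
      rintro n rfl
      rw [Set.ncard_eq_one]
      refine ⟨[0], Set.ext fun L => ⟨?_, ?_⟩⟩
      · rintro ⟨h, -, -⟩
        obtain ⟨r, rfl⟩ := List.length_eq_one_iff.1 h
        rw [Subsingleton.elim r 0]
        rfl
      · rintro rfl
        exact ⟨rfl, rfl, hstat 0⟩
    rw [this _ Finsupp.single_eq_same, Finsupp.single_eq_same]
    simp
  · rw [(Set.ncard_eq_zero (lists_finite _ _ _)).2, Nat.cast_zero, zero_div]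
    rw [Set.eq_empty_iff_forall_notMem]
    rintro L ⟨hL, -, hs⟩
    obtain ⟨r, rfl⟩ := List.length_eq_one_iff.1 hL
    exact h (by rw [← hs, hstat])

end ListClass

end GeneratingFunctions

/-! ### Translation between closed walks in `SimpleGraph` and lists of vertices. -/

section Interface

set_option linter.unusedSectionVars false

variable {V : Type*} [DecidableEq V]

lemma edges_eq_pairs {G : SimpleGraph V} {u v : V} (p : G.Walk u v) :
    p.edges = pairs p.support := by
  induction p with
  | nil => rfl
  | cons h p ih => cases p <;> simp_all

lemma head?_support (W : ClosedWalk V) : W.2.support.head? = some W.1 := by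
  rw [List.head?_eq_some_head W.2.support_ne_nil, SimpleGraph.Walk.head_support]

lemma getLast?_support (W : ClosedWalk V) : W.2.support.getLast? = some W.1 := by
  rw [List.getLast?_eq_getLast_of_ne_nil W.2.support_ne_nil, SimpleGraph.Walk.getLast_support]

lemma support_injective : Function.Injective fun W : ClosedWalk V => W.2.support := by
  rintro ⟨r, p⟩ ⟨r', p'⟩ h
  have h' : some r = some r' := by
    rw [← head?_support ⟨r, p⟩, ← head?_support ⟨r', p'⟩]
    exact congrArg _ h
  obtain rfl := Option.some_inj.1 h'
  exact congrArg _ (SimpleGraph.Walk.ext_support h)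

lemma not_isDiag_of_mem_edges (W : ClosedWalk V) {e : Sym2 V} (he : e ∈ W.2.edges) :
    ¬ e.IsDiag :=
  (⊤ : SimpleGraph V).not_isDiag_of_mem_edgeSet (W.2.edges_subset_edgeSet he)

lemma IsTreeList.exists_closedWalk {L : List V} (h : IsTreeList L) :
    ∃ W : ClosedWalk V, W.2.support = L := by
  have hchain : L.IsChain (⊤ : SimpleGraph V).Adj := by
    have h1 := h.1
    clear h
    induction L with
    | nil => exact List.isChain_nil
    | cons a l ih =>
      cases l with
      | nil => exact List.isChain_singleton _
      | cons b l =>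
        rw [List.isChain_cons_cons]
        refine ⟨?_, ih fun e he => h1 e (by simp [he])⟩
        simpa using h1 s(a, b) (by simp)
  have hcl := h.2.1
  rw [List.head?_eq_some_head h.ne_nil, List.getLast?_eq_getLast_of_ne_nil h.ne_nil,
    Option.some_inj] at hcl
  refine ⟨⟨L.head h.ne_nil, (SimpleGraph.Walk.ofSupport L h.ne_nil hchain).copy rfl hcl.symm⟩, ?_⟩
  simp

lemma mem_neighborSet_inducedGraph (W : ClosedWalk V) (x y : V) :
    y ∈ (inducedGraph W).neighborSet x ↔ s(x, y) ∈ pairs W.2.support := by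
  rw [SimpleGraph.Subgraph.mem_neighborSet, inducedGraph,
    SimpleGraph.Walk.adj_toSubgraph_iff_mem_edges, edges_eq_pairs]

lemma coe_star (W : ClosedWalk V) (x : V) :
    (star W.2.support x : Set (Sym2 V)) = (s(x, ·)) '' (inducedGraph W).neighborSet x := by
  ext e
  simp only [Finset.mem_coe, mem_star, Set.mem_image, mem_neighborSet_inducedGraph]
  constructor
  · rintro ⟨he, y, rfl⟩
    exact ⟨y, he, rfl⟩
  · rintro ⟨y, hy, rfl⟩
    exact ⟨hy, Sym2.mem_mk_left _ _⟩

lemma card_star (W : ClosedWalk V) (x : V) :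
    (star W.2.support x).card = ((inducedGraph W).neighborSet x).ncard := by
  rw [← Set.ncard_coe_finset, coe_star, Set.ncard_image_of_injective]
  exact fun a b h => Sym2.congr_right.1 h

lemma isSimpleEdge_iff (W : ClosedWalk V) (e : Sym2 V) :
    IsSimpleEdge W e ↔ (pairs W.2.support).count e = 2 := by
  rw [IsSimpleEdge, edges_eq_pairs]

lemma not_thick_iff (W : ClosedWalk V) (x : V) : ¬ Thick W.2.support x ↔
    ∀ y ∈ (inducedGraph W).neighborSet x, IsSimpleEdge W s(x, y) := by
  simp only [Thick, not_exists, not_and, not_not, isSimpleEdge_iff]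
  rw [← Set.forall_mem_image (f := fun y => s(x, y))
    (p := fun e => (pairs W.2.support).count e = 2), ← coe_star]
  rfl

lemma IsSimpleEdge.mem_neighborSet {W : ClosedWalk V} {x y : V} (h : IsSimpleEdge W s(x, y)) :
    y ∈ (inducedGraph W).neighborSet x := by
  rw [mem_neighborSet_inducedGraph]
  rw [isSimpleEdge_iff] at h
  exact List.count_pos_iff.1 (by omega)

lemma isLeaf_and_isSimpleEdge_iff (W : ClosedWalk V) (x : V) :
    (∃ y, IsLeaf W x ∧ IsSimpleEdge W s(x, y)) ↔
      (star W.2.support x).card = 1 ∧ ¬ Thick W.2.support x := by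
  rw [card_star, not_thick_iff, IsLeaf]
  constructor
  · rintro ⟨y, h1, h2⟩
    refine ⟨h1, fun z hz => ?_⟩
    obtain ⟨a, ha⟩ := Set.ncard_eq_one.1 h1
    have hy := h2.mem_neighborSet
    rw [ha, Set.mem_singleton_iff] at hz hy
    rwa [hz, ← hy]
  · rintro ⟨h1, h2⟩
    obtain ⟨a, ha⟩ := Set.ncard_eq_one.1 h1
    exact ⟨a, h1, h2 a (by rw [ha]; rfl)⟩

lemma exists_canSmooth_iff (W : ClosedWalk V) (x : V) :
    (∃ a b, CanSmooth W x a b) ↔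
      x ≠ W.1 ∧ (star W.2.support x).card = 2 ∧ ¬ Thick W.2.support x := by
  rw [card_star, not_thick_iff]
  constructor
  · rintro ⟨a, b, h1, h2, h3, h4, h5⟩
    refine ⟨h1, by rw [h3, Set.ncard_pair h2], ?_⟩
    rw [h3]
    rintro y (rfl | rfl) <;> assumption
  · rintro ⟨h1, h2, h3⟩
    obtain ⟨a, b, hab, h⟩ := Set.ncard_eq_two.1 h2
    exact ⟨a, b, h1, hab, h, h3 a (by rw [h]; simp), h3 b (by rw [h]; simp)⟩

lemma mem_support_of_star {L : List V} {x : V} (h : 0 < (star L x).card) : x ∈ L := by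
  obtain ⟨e, he⟩ := Finset.card_pos.1 h
  exact mem_of_mem_pairs (mem_star.1 he).1 (mem_star.1 he).2

/-- Pruning and root moves are excluded by the conditions at degree 1, smoothing by the condition at
degree 2 away from the root; each says that not all edges at the vertex are simple. -/
lemma irreducible_iff (W : ClosedWalk V) (h : IsTreeList W.2.support) :
    ((∀ x y, ¬ CanPrune W x y) ∧ (∀ y, ¬ CanMoveRoot W y) ∧ ∀ x a b, ¬ CanSmooth W x a b) ↔
      IsKernelList W.2.support := by
  have h1 : (∀ x y, ¬ CanPrune W x y) ↔
      ∀ x, x ≠ W.1 → (star W.2.support x).card = 1 → Thick W.2.support x := by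
    refine forall_congr' fun x => ⟨fun H hx hc => ?_, fun H y hy => ?_⟩
    · by_contra ht
      obtain ⟨y, hy⟩ := (isLeaf_and_isSimpleEdge_iff W x).2 ⟨hc, ht⟩
      exact H y ⟨hx, hy⟩
    · have := (isLeaf_and_isSimpleEdge_iff W x).1 ⟨y, hy.2⟩
      exact this.2 (H hy.1 this.1)
  have h2 : (∀ y, ¬ CanMoveRoot W y) ↔
      ((star W.2.support W.1).card = 1 → Thick W.2.support W.1) := by
    refine ⟨fun H hc => ?_, fun H y hy => ?_⟩
    · by_contra ht
      obtain ⟨y, hy⟩ := (isLeaf_and_isSimpleEdge_iff W W.1).2 ⟨hc, ht⟩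
      exact H y hy
    · have := (isLeaf_and_isSimpleEdge_iff W W.1).1 ⟨y, hy⟩
      exact this.2 (H this.1)
  have h3 : (∀ x a b, ¬ CanSmooth W x a b) ↔
      ∀ x, x ≠ W.1 → (star W.2.support x).card = 2 → Thick W.2.support x := by
    refine forall_congr' fun x => ⟨fun H hx hc => ?_, fun H a b hab => ?_⟩
    · by_contra ht
      obtain ⟨a, b, hab⟩ := (exists_canSmooth_iff W x).2 ⟨hx, hc, ht⟩
      exact H a b hab
    · have := (exists_canSmooth_iff W x).1 ⟨a, b, hab⟩
      exact this.2.2 (H this.1 this.2.1)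
  rw [h1, h2, h3, IsKernelList, IsRootedKernel, head?_support]
  simp only [h, true_and, Option.some_inj, ne_eq]
  constructor
  · rintro ⟨H1, H2, H3⟩
    refine ⟨fun x _ hx hc => hc.elim (H1 x (Ne.symm hx)) (H3 x (Ne.symm hx)), ?_⟩
    rintro x - rfl
    exact H2
  · rintro ⟨H1, H2⟩
    exact ⟨fun x hx hc => H1 x (mem_support_of_star (by omega)) (Ne.symm hx) (Or.inl hc),
      fun hc => H2 W.1 W.2.start_mem_support rfl hc,
      fun x hx hc => H1 x (mem_support_of_star (by omega)) (Ne.symm hx) (Or.inr hc)⟩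

lemma length_lt_of_filter {W W' : ClosedWalk V} {e : Sym2 V} (h : IsSimpleEdge W e)
    (h' : W'.2.edges = W.2.edges.filter (· ≠ e)) : W'.2.length < W.2.length := by
  rw [← SimpleGraph.Walk.length_edges, ← SimpleGraph.Walk.length_edges, h']
  refine List.length_filter_lt_length_iff_exists.2 ⟨e, ?_, by simp⟩
  exact List.count_pos_iff.1 (by rw [h]; simp)

lemma PruneStep.length_lt {W W' : ClosedWalk V} (h : PruneStep W W') :
    W'.2.length < W.2.length := by
  obtain ⟨x, y, h1, -, h2⟩ := h
  exact length_lt_of_filter h1.2.2 h2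

lemma MoveRootStep.length_lt {W W' : ClosedWalk V} (h : MoveRootStep W W') :
    W'.2.length < W.2.length := by
  obtain ⟨y, h1, -, h2⟩ := h
  exact length_lt_of_filter h1.2 h2

lemma SmoothStep.length_lt {W W' : ClosedWalk V} (h : SmoothStep W W') :
    W'.2.length < W.2.length := by
  obtain ⟨x, a, b, h1, h2⟩ := h
  have hx : x ∈ W.2.support := by
    refine mem_of_mem_pairs (e := s(x, a)) ?_ (Sym2.mem_mk_left _ _)
    exact (mem_neighborSet_inducedGraph _ _ _).1 h1.2.2.2.1.mem_neighborSet
  have : W'.2.support.length < W.2.support.length := by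
    rw [h2]
    exact List.length_filter_lt_length_iff_exists.2 ⟨x, hx, by simp⟩
  simpa using this

lemma eq_or_length_lt_of_reflTransGen {r : ClosedWalk V → ClosedWalk V → Prop}
    (hr : ∀ W W', r W W' → W'.2.length < W.2.length) {W W' : ClosedWalk V}
    (h : Relation.ReflTransGen r W W') : W = W' ∨ W'.2.length < W.2.length := by
  induction h with
  | refl => exact Or.inl rfl
  | tail _ h2 ih =>
    have := hr _ _ h2
    rcases ih with rfl | ih
    · exact Or.inr this
    · exact Or.inr (this.trans ih)

/-- Every reduction step shortens the walk, so a reduction from `W` to itself consists of no steps.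
-/
lemma isKernelOf_self_iff (W : ClosedWalk V) : IsKernelOf W W ↔
    (∀ x y, ¬ CanPrune W x y) ∧ (∀ y, ¬ CanMoveRoot W y) ∧ ∀ x a b, ¬ CanSmooth W x a b := by
  constructor
  · rintro ⟨W₁, W₂, h1, h1', h2, h2', h3, h3'⟩
    have a1 := eq_or_length_lt_of_reflTransGen (fun _ _ => PruneStep.length_lt) h1
    have a2 := eq_or_length_lt_of_reflTransGen (fun _ _ => MoveRootStep.length_lt) h2
    have a3 := eq_or_length_lt_of_reflTransGen (fun _ _ => SmoothStep.length_lt) h3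
    rcases a1 with rfl | a1 <;> rcases a2 with rfl | a2 <;> rcases a3 with a3 | a3 <;>
      first
      | omega
      | exact ⟨h1', h2', h3'⟩
      | (obtain rfl := a3; omega)
  · rintro ⟨h1, h2, h3⟩
    exact ⟨W, W, .refl, h1, .refl, h2, .refl, h3⟩

/-- The induced graph of a walk is connected, so it is a tree as soon as it has one more vertex than
edges. -/
lemma isTreeWalk_iff [Fintype V] (W : ClosedWalk V) :
    IsTreeWalk W ↔ IsTreeList W.2.support ∧ W.2.support.toFinset = Finset.univ := by
  have h1 : (∀ x, x ∈ W.2.support) ↔ W.2.support.toFinset = Finset.univ := by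
    simp [Finset.eq_univ_iff_forall]
  have h2 : (inducedGraph W).coe.IsTree ↔ IsTreeList W.2.support := by
    have hc : (inducedGraph W).coe.Connected :=
      SimpleGraph.Subgraph.connected_iff'.1 W.2.toSubgraph_connected
    have hv : Nat.card (inducedGraph W).verts = W.2.support.toFinset.card := by
      rw [Nat.card_coe_set_eq, inducedGraph, SimpleGraph.Walk.verts_toSubgraph,
        ← Set.ncard_coe_finset]
      congr 1
      ext
      simp
    have he : Nat.card (inducedGraph W).coe.edgeSet = (pairs W.2.support).toFinset.card := by
      rw [Nat.card_coe_set_eq, ← Set.ncard_image_of_injective _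
        (Sym2.map.injective Subtype.val_injective), SimpleGraph.Subgraph.image_coe_edgeSet_coe,
        ← Set.ncard_coe_finset]
      congr 1
      ext e
      rw [inducedGraph, SimpleGraph.Walk.mem_edges_toSubgraph, edges_eq_pairs]
      simp
    rw [SimpleGraph.isTree_iff_connected_and_card, hv, he, IsTreeList, head?_support,
      getLast?_support, ← edges_eq_pairs]
    simp only [hc, true_and]
    rw [eq_comm]
    exact (and_iff_right fun e he => not_isDiag_of_mem_edges W he).symm
  rw [IsTreeWalk, h1, h2, and_comm]

lemma isKernelWalk_iff [Fintype V] (W : ClosedWalk V) :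
    IsKernelWalk W ↔ IsKernelList W.2.support ∧ W.2.support.toFinset = Finset.univ := by
  rw [IsKernelWalk, isTreeWalk_iff, isKernelOf_self_iff]
  constructor
  · rintro ⟨⟨h1, h2⟩, h3⟩
    exact ⟨(irreducible_iff W h1).1 h3, h2⟩
  · rintro ⟨h1, h2⟩
    exact ⟨⟨h1.1.1, h2⟩, (irreducible_iff W h1.1.1).2 h1⟩

lemma isSuperreduced_iff [Fintype V] (W : ClosedWalk V) :
    IsSuperreduced W ↔ IsSuperreducedList W.2.support ∧ W.2.support.toFinset = Finset.univ := by
  rw [IsSuperreduced, isTreeWalk_iff, IsSuperreducedList, edges_eq_pairs]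
  simp only [isSimpleEdge_iff]
  tauto

lemma numSimple_eq (W : ClosedWalk V) : numSimple W = (simpleEdges W.2.support).card := by
  rw [numSimple, simpleEdges, ← edges_eq_pairs]
  congr

/-- Traversal counts of edges are positive and even, so the natural-number division and subtraction
are exact and the excesses sum to `ℓ` minus the number of edges. -/
lemma excess_add_card {W : ClosedWalk V} (h : IsTreeList W.2.support) :
    excess W + W.2.support.toFinset.card = stat W.2.support 2 + 1 := by
  rw [excess, edges_eq_pairs, h.2.2, ← add_assoc]
  congr 1
  have h1 := List.sum_toFinset_count_eq_length (pairs W.2.support)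
  have h2 := h.length_eq
  rw [length_pairs] at h1
  have h3 : ∑ e ∈ (pairs W.2.support).toFinset, (pairs W.2.support).count e =
      2 * ∑ e ∈ (pairs W.2.support).toFinset, ((pairs W.2.support).count e / 2 - 1 + 1) := by
    rw [Finset.mul_sum]
    refine Finset.sum_congr rfl fun e he => ?_
    obtain ⟨k, hk⟩ := h.even_count e
    have := List.count_pos_iff.2 (List.mem_toFinset.1 he)
    omega
  rw [Finset.sum_add_distrib, Finset.sum_const, smul_eq_mul, mul_one] at h3
  omega

lemma length_eq_iff {W : ClosedWalk V} (h : IsTreeList W.2.support) (l : ℕ) :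
    W.2.length = 2 * l ↔ stat W.2.support 2 = l := by
  have h1 := h.length_eq
  rw [SimpleGraph.Walk.length_support] at h1
  omega

lemma IsTreeList.card_le {L : List V} (h : IsTreeList L) : stat L 1 ≤ stat L 2 + 1 := by
  obtain ⟨W, rfl⟩ := h.exists_closedWalk
  have := excess_add_card h
  rw [stat_one]
  omega

/-- Each of the `m - 1` edges is traversed at least four times, so `4 (m - 1) ≤ 2 ℓ`. -/
lemma IsSuperreducedList.card_le {L : List V} (h : IsSuperreducedList L) :
    2 * stat L 1 ≤ stat L 2 + 2 := by
  have h1 := List.sum_toFinset_count_eq_length (pairs L)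
  have h2 := h.1.length_eq
  rw [length_pairs] at h1
  have h3 : (pairs L).toFinset.card * 4 ≤ ∑ e ∈ (pairs L).toFinset, (pairs L).count e := by
    rw [← smul_eq_mul, ← Finset.sum_const]
    refine Finset.sum_le_sum fun e he => ?_
    obtain ⟨k, hk⟩ := h.1.even_count e
    have := List.count_pos_iff.2 (List.mem_toFinset.1 he)
    have := h.2 e (List.mem_toFinset.1 he)
    omega
  rw [stat_one, h.1.2.2]
  omega

end Interface

/-! ### The counts of the statement as coefficients of class generating functions. -/

section Counts

open ListClass

/-- The exponents `(s, m, ℓ)`. -/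
noncomputable def exponent (s m l : ℕ) : Fin 3 →₀ ℕ :=
  Finsupp.equivFunOnFinite.symm ![s, m, l]

@[simp] lemma exponent_zero (s m l : ℕ) : exponent s m l 0 = s := rfl
@[simp] lemma exponent_one (s m l : ℕ) : exponent s m l 1 = m := rfl
@[simp] lemma exponent_two (s m l : ℕ) : exponent s m l 2 = l := rfl

lemma eq_exponent_iff {d : Fin 3 →₀ ℕ} {s m l : ℕ} :
    d = exponent s m l ↔ d 0 = s ∧ d 1 = m ∧ d 2 = l := by
  constructor
  · rintro rfl
    simp
  · rintro ⟨rfl, rfl, rfl⟩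
    ext i
    fin_cases i <;> rfl

lemma card_closedWalk_eq (P : ListClass) {m : ℕ} (s l : ℕ) (p : ClosedWalk (Fin m) → Prop)
    (hP : ∀ L : List (Fin m), P.pred L → IsTreeList L)
    (hp : ∀ W, p W ↔ W.2.support ∈ P.lists Finset.univ (exponent s m l)) :
    Nat.card {W // p W} = P.count (exponent s m l) := by
  have : {W | p W}.ncard = (P.lists (Finset.univ : Finset (Fin m)) (exponent s m l)).ncard := by
    refine Set.ncard_congr (fun W _ => W.2.support) (fun W hW => (hp W).1 hW)
      (fun W W' _ _ h => support_injective h) fun L hL => ?_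
    obtain ⟨W, rfl⟩ := (hP L hL.1).exists_closedWalk
    exact ⟨W, (hp W).2 hL, rfl⟩
  exact this

lemma superCount_eq (m l : ℕ) : superCount m l = super.count (exponent 0 m l) := by
  refine card_closedWalk_eq super 0 l _ (fun L h => h.1) fun W => ?_
  rw [isSuperreduced_iff]
  constructor
  · rintro ⟨⟨h1, h2⟩, h3⟩
    refine ⟨h1, h2, eq_exponent_iff.2 ⟨?_, by simp [h2], (length_eq_iff h1.1 l).1 h3⟩⟩
    rw [stat_zero, h1.simpleEdges_eq, Finset.card_empty]
  · rintro ⟨h1, h2, h3⟩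
    exact ⟨⟨h1, h2⟩, (length_eq_iff h1.1 l).2 (eq_exponent_iff.1 h3).2.2⟩

lemma superCountExcess_eq (ξ m l : ℕ) :
    superCountExcess ξ m l = if m + ξ = l + 1 then superCount m l else 0 := by
  have key : ∀ W : ClosedWalk (Fin m), IsSuperreduced W → W.2.length = 2 * l →
      (excess W = ξ ↔ m + ξ = l + 1) := by
    intro W hW hl
    rw [isSuperreduced_iff] at hW
    have h1 := excess_add_card hW.1.1
    rw [(length_eq_iff hW.1.1 l).1 hl, hW.2, Finset.card_univ, Fintype.card_fin] at h1
    omega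
  split_ifs with h
  · refine Nat.card_congr (Equiv.subtypeEquivRight fun W => ?_)
    have := key W
    tauto
  · have : IsEmpty {W : ClosedWalk (Fin m) //
        IsSuperreduced W ∧ W.2.length = 2 * l ∧ excess W = ξ} :=
      ⟨fun W => h ((key W.1 W.2.1 W.2.2.1).1 W.2.2.2)⟩
    exact Nat.card_of_isEmpty

/-- Length and excess determine the size, so only one `m` contributes to the disjoint union over all
sizes. -/
lemma kernelCount_eq {ξ s m l : ℕ} (h : m + ξ = l + 1) :
    kernelCount ξ s l = kernel.count (exponent s m l) := by
  have key : ∀ {n : ℕ} {W : ClosedWalk (Fin n)}, IsKernelWalk W → W.2.length = 2 * l →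
      (excess W = ξ ↔ n = m) := by
    intro n W hW hl
    rw [isKernelWalk_iff] at hW
    have h1 := excess_add_card hW.1.1.1
    rw [(length_eq_iff hW.1.1.1 l).1 hl, hW.2, Finset.card_univ, Fintype.card_fin] at h1
    omega
  have hm : kernelCount ξ s l = Nat.card {W : ClosedWalk (Fin m) //
      IsKernelWalk W ∧ W.2.length = 2 * l ∧ excess W = ξ ∧ numSimple W = s} := by
    symm
    refine Nat.card_congr (Equiv.ofBijective (fun W => ⟨m, W⟩) ⟨fun _ _ h => by simpa using h, ?_⟩)
    rintro ⟨n, W⟩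
    obtain rfl := (key W.2.1 W.2.2.1).1 W.2.2.2.1
    exact ⟨W, rfl⟩
  rw [hm]
  refine card_closedWalk_eq kernel s l _ (fun L h => h.1.1) fun W => ?_
  have hW := isKernelWalk_iff W
  constructor
  · rintro ⟨h1, h2, h3, h4⟩
    obtain ⟨h5, h6⟩ := hW.1 h1
    exact ⟨h5, h6, eq_exponent_iff.2 ⟨by rw [stat_zero, ← numSimple_eq, h4], by simp [h6],
      (length_eq_iff h5.1.1 l).1 h2⟩⟩
  · rintro ⟨h1, h2, h3⟩
    obtain ⟨h4, -, h5⟩ := eq_exponent_iff.1 h3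
    have h6 := (length_eq_iff h1.1.1 l).2 h5
    have h7 := hW.2 ⟨h1, h2⟩
    exact ⟨h7, h6, (key h7 h6).2 rfl, by rw [numSimple_eq, ← h4, stat_zero]⟩

lemma ListClass.count_eq_zero {P : ListClass} {d : Fin 3 →₀ ℕ}
    (h : ∀ L : List (Fin (d 1)), P.pred L → stat L ≠ d) : P.count d = 0 := by
  rw [ListClass.count, Set.ncard_eq_zero (P.lists_finite _ d), Set.eq_empty_iff_forall_notMem]
  exact fun L hL => h L hL.1 hL.2.2

lemma coeff_kernelGFExcess (ξ : ℕ) (d : Fin 3 →₀ ℕ) :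
    MvPowerSeries.coeff d (kernelGFExcess ξ) =
      if d 1 + ξ = d 2 + 1 then MvPowerSeries.coeff d kernel.gf else 0 := by
  change (if d 1 + ξ = d 2 + 1 then (kernelCount ξ (d 0) (d 2) : ℚ) / (d 1).factorial else 0) = _
  split_ifs with h
  · rw [kernelCount_eq h, coeff_gf, ← eq_exponent_iff.2 ⟨rfl, rfl, rfl⟩]
  · rfl

lemma finite_coeff_kernelGFExcess (d : Fin 3 →₀ ℕ) :
    {ξ : ℕ | MvPowerSeries.coeff d (kernelGFExcess ξ) ≠ 0}.Finite := by
  refine (Set.finite_Iic (d 2 + 1)).subset fun ξ hξ => ?_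
  simp only [Set.mem_ofPred_eq, coeff_kernelGFExcess, ne_eq, ite_eq_right_iff, Classical.not_imp]
    at hξ
  rw [Set.mem_Iic]
  omega

lemma kernelGF_eq : kernelGF = kernel.gf := by
  ext d
  change ∑ᶠ ξ : ℕ, MvPowerSeries.coeff d (kernelGFExcess ξ) = _
  simp only [coeff_kernelGFExcess]
  -- The single contributing excess is `ℓ + 1 - m`. If this is negative, no tree walk exists.
  by_cases h : d 1 ≤ d 2 + 1
  · rw [finsum_eq_single _ (d 2 + 1 - d 1), if_pos (by omega)]
    intro ξ hξ
    rw [if_neg (by omega)]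
  · rw [coeff_gf, ListClass.count_eq_zero]
    · simp
    · intro L hL hs
      have hL' : IsKernelList L := hL
      exact h (hs ▸ hL'.1.1.card_le)

lemma coeff_kernelGFExcess_eq (ξ : ℕ) (d : Fin 3 →₀ ℕ) :
    MvPowerSeries.coeff d (kernelGFExcess ξ) =
      if d 1 + ξ = d 2 + 1 then MvPowerSeries.coeff d kernelGF else 0 := by
  rw [kernelGF_eq, coeff_kernelGFExcess]

lemma superCount_eq_zero {m l : ℕ} (h : l + 2 < 2 * m) : superCount m l = 0 := by
  rw [superCount_eq, ListClass.count_eq_zero]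
  intro L hL hs
  have hL' : IsSuperreducedList L := hL
  have := hL'.card_le
  rw [hs] at this
  simp only [exponent_one, exponent_two] at this
  omega

lemma superCount_one_zero : superCount 1 0 = 1 := by
  rw [superCount_eq]
  have h := congrArg (MvPowerSeries.coeff (exponent 0 1 0)) singleton_eq
  rw [coeff_gf, coeff_X, if_pos (by symm; rw [eq_exponent_iff]; simp)] at h
  simp only [exponent_one, Nat.factorial_one, Nat.cast_one, div_one, Nat.cast_eq_one] at h
  refine Eq.trans ?_ h
  change (super.lists (Finset.univ : Finset (Fin 1)) _).ncard =
    (singleton.lists (Finset.univ : Finset (Fin 1)) _).ncard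
  congr 1
  ext L
  refine ⟨fun hL => ⟨?_, hL.2⟩, fun hL => ⟨?_, hL.2⟩⟩
  · have hL' : IsSuperreducedList L := hL.1
    have := hL'.1.length_eq
    rwa [hL.2.2] at this
  · obtain ⟨r, rfl⟩ := List.length_eq_one_iff.1 hL.1
    exact ⟨(isRootedKernelFrom_singleton r).1.1, by simp⟩

lemma coeff_superLength (p : ℕ) (d : Fin 3 →₀ ℕ) :
    MvPowerSeries.coeff d (superLength p).gf =
      if d 0 = 0 ∧ p = 2 * d 2 then (superCount (d 1) (d 2) : ℚ) / (d 1).factorial else 0 := by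
  rw [coeff_gf]
  split_ifs with h
  · congr 2
    rw [superCount_eq, ← eq_exponent_iff.2 ⟨h.1, rfl, rfl⟩, ListClass.count, ListClass.count]
    congr 1
    ext L
    refine ⟨fun hL => ⟨hL.1.1, hL.2⟩, fun hL => ⟨⟨hL.1, ?_⟩, hL.2⟩⟩
    have hL' : IsSuperreducedList L := hL.1
    rw [hL'.1.length_eq, hL.2.2, h.2]
  · rw [ListClass.count_eq_zero, Nat.cast_zero, zero_div]
    rintro L ⟨hL, hp⟩ hs
    have := hL.1.length_eq
    rw [← hs, stat_zero, hL.simpleEdges_eq, Finset.card_empty] at h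
    exact h ⟨rfl, by omega⟩

lemma coeff_rootedFrom_eq_zero {p : ℕ} {d : Fin 3 →₀ ℕ} (h : 2 * d 2 < p) :
    MvPowerSeries.coeff d (rootedFrom p).gf = 0 := by
  rw [coeff_gf, ListClass.count_eq_zero, Nat.cast_zero, zero_div]
  intro L hL hs
  have hL' : IsRootedKernelFrom p L := hL
  have h1 := hL'.2.1
  have h2 := hL'.1.1.length_eq
  rw [hs] at h2
  omega

end Counts

/-! ### The functional equation for `K`. -/

section FunctionalEquation

open ListClass

lemma hasSubst_two (G : MvPowerSeries (Fin 3) ℚ) :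
    HasSubst ![(X 1 : MvPowerSeries (Fin 3) ℚ), X 2 * G] := by
  refine hasSubst_of_constantCoeff_zero fun i => ?_
  fin_cases i <;> simp

lemma coeff_substTwo_eq_zero {F : MvPowerSeries (Fin 2) ℚ} {G : MvPowerSeries (Fin 3) ℚ}
    {d : Fin 3 →₀ ℕ} (h : ∀ e, MvPowerSeries.coeff e F ≠ 0 →
      MvPowerSeries.coeff d (X 1 ^ e 0 * (X 2 * G) ^ e 1) = 0) :
    MvPowerSeries.coeff d (substTwo F (X 1) (X 2 * G)) = 0 := by
  rw [substTwo, coeff_subst (hasSubst_two G)]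
  refine finsum_eq_zero_of_forall_eq_zero fun e => ?_
  by_cases he : MvPowerSeries.coeff e F = 0
  · rw [he, zero_smul]
  · have := h e he
    rw [Finsupp.prod_fintype _ _ (by simp), Fin.prod_univ_two]
    simpa using Or.inr this

lemma substTwo_monomial (G : MvPowerSeries (Fin 3) ℚ) (e : Fin 2 →₀ ℕ) (r : ℚ) :
    substTwo (monomial e r) (X 1) (X 2 * G) = r • (X 1 ^ e 0 * (X 2 * G) ^ e 1) := by
  rw [substTwo, subst_monomial (hasSubst_two G), Finsupp.prod_fintype _ _ (by simp),
    Fin.prod_univ_two]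
  simp [Algebra.smul_def]

lemma coeff_mul_eq_zero {σ : Type*} {F G : MvPowerSeries σ ℚ} {d : σ →₀ ℕ}
    (h : ∀ e ≤ d, MvPowerSeries.coeff e G = 0) : MvPowerSeries.coeff d (F * G) = 0 := by
  classical
  rw [coeff_mul]
  refine Finset.sum_eq_zero fun q hq => ?_
  rw [h q.2, mul_zero]
  rw [← Finset.HasAntidiagonal.mem_antidiagonal.1 hq]
  exact le_add_self

/-- The series `1 - u z (K - v)`. -/
noncomputable def kernelDenominator : MvPowerSeries (Fin 3) ℚ :=
  1 - X 0 * X 2 * (kernelGF - X 1)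

lemma constantCoeff_kernelDenominator : constantCoeff kernelDenominator = 1 := by
  simp [kernelDenominator]

/-- The case distinction at the next edge, with the term for a simple edge moved to the left. -/
lemma kernelDenominator_mul_rootedFrom (p : ℕ) :
    kernelDenominator * (rootedFrom p).gf = (rootedFrom (p + 1)).gf + (superLength p).gf := by
  have h1 := rootedFrom_eq p
  have h2 := rootedAt_eq p
  have h3 := kernel_eq
  rw [singleton_eq] at h3
  rw [kernelDenominator, kernelGF_eq]
  linear_combination h1 + h2 - X 0 * X 2 * (rootedFrom p).gf * h3

lemma superLength_odd (l : ℕ) : (superLength (2 * l + 1)).gf = 0 := by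
  ext d
  rw [coeff_superLength, if_neg (by omega)]
  rfl

lemma inv_sq {σ : Type*} (D : MvPowerSeries σ ℚ) : (D ^ 2)⁻¹ = D⁻¹ ^ 2 := by
  rw [pow_two, MvPowerSeries.mul_inv_rev, pow_two]

/-- Two steps of the recursion are taken at a time, since there are no superreduced walks of odd
length. -/
lemma rootedFrom_zero_eq_sum (N : ℕ) : (rootedFrom 0).gf =
    ∑ l ∈ Finset.range N, kernelDenominator⁻¹ ^ (2 * l + 1) * (superLength (2 * l)).gf +
      kernelDenominator⁻¹ ^ (2 * N) * (rootedFrom (2 * N)).gf := by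
  induction N with
  | zero => simp
  | succ N ih =>
    rw [ih, Finset.sum_range_succ]
    have h1 := kernelDenominator_mul_rootedFrom (2 * N)
    have h2 := kernelDenominator_mul_rootedFrom (2 * N + 1)
    rw [superLength_odd] at h2
    have h3 : kernelDenominator⁻¹ * kernelDenominator = 1 :=
      MvPowerSeries.inv_mul_cancel _ (by simp [constantCoeff_kernelDenominator])
    rw [show 2 * (N + 1) = 2 * N + 1 + 1 by ring]
    have h4 : (rootedFrom (2 * N)).gf = kernelDenominator⁻¹ * (superLength (2 * N)).gf +
        kernelDenominator⁻¹ ^ 2 * (rootedFrom (2 * N + 1 + 1)).gf := by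
      linear_combination (kernelDenominator⁻¹) * h1 + kernelDenominator⁻¹ ^ 2 * h2 -
        (rootedFrom (2 * N)).gf * h3 - kernelDenominator⁻¹ * (rootedFrom (2 * N + 1)).gf * h3
    rw [h4]
    ring

/-- The exponents `(m, ℓ)`. -/
noncomputable def exponentTwo (m l : ℕ) : Fin 2 →₀ ℕ := Finsupp.equivFunOnFinite.symm ![m, l]

@[simp] lemma exponentTwo_zero (m l : ℕ) : exponentTwo m l 0 = m := rfl
@[simp] lemma exponentTwo_one (m l : ℕ) : exponentTwo m l 1 = l := rfl

lemma eq_exponentTwo_iff {e : Fin 2 →₀ ℕ} {m l : ℕ} :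
    e = exponentTwo m l ↔ e 0 = m ∧ e 1 = l := by
  constructor
  · rintro rfl
    simp
  · rintro ⟨rfl, rfl⟩
    ext i
    fin_cases i <;> rfl

lemma coeff_superGF (e : Fin 2 →₀ ℕ) :
    MvPowerSeries.coeff e superGF = (superCount (e 0) (e 1) : ℚ) / (e 0).factorial := rfl

/-- The part of `S` of degree less than `N` in `z`. -/
noncomputable def superTrunc (N : ℕ) : MvPowerSeries (Fin 2) ℚ :=
  ∑ l ∈ Finset.range N, ∑ m ∈ Finset.range (l + 2),
    monomial (exponentTwo m l) ((superCount m l : ℚ) / m.factorial)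

lemma coeff_superTrunc {N : ℕ} {e : Fin 2 →₀ ℕ} (he : e 1 < N) :
    MvPowerSeries.coeff e (superTrunc N) = MvPowerSeries.coeff e superGF := by
  classical
  simp only [superTrunc, map_sum, coeff_monomial, eq_exponentTwo_iff]
  rw [Finset.sum_eq_single (e 1), Finset.sum_eq_single (e 0)]
  · simp [coeff_superGF]
  · intro m _ hm
    rw [if_neg (by tauto)]
  · intro hm
    rw [Finset.mem_range] at hm
    rw [superCount_eq_zero (by omega)]
    simp
  · intro l _ hl
    exact Finset.sum_eq_zero fun m _ => by rw [if_neg (by tauto)]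
  · intro hl
    simp [he] at hl

lemma monomial_exponent (s m l : ℕ) : (monomial (exponent s m l) (1 : ℚ)) =
    (X 0 ^ s * X 1 ^ m * X 2 ^ l : MvPowerSeries (Fin 3) ℚ) := by
  rw [X_pow_eq, X_pow_eq, X_pow_eq, monomial_mul_monomial, monomial_mul_monomial, one_mul, one_mul]
  congr 1
  congr 1
  symm
  rw [eq_exponent_iff]
  simp

lemma superLength_even (l : ℕ) : (superLength (2 * l)).gf =
    ∑ m ∈ Finset.range (l + 2), ((superCount m l : ℚ) / m.factorial) • (X 1 ^ m * X 2 ^ l) := by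
  classical
  ext d
  have h : ∀ m, (X 1 ^ m * X 2 ^ l : MvPowerSeries (Fin 3) ℚ) = monomial (exponent 0 m l) 1 :=
    fun m => by rw [monomial_exponent, pow_zero, one_mul]
  simp only [coeff_superLength, map_sum, map_smul, h, coeff_monomial, eq_exponent_iff]
  rw [Finset.sum_eq_single (d 1)]
  · by_cases hd : d 0 = 0 ∧ l = d 2
    · rw [if_pos ⟨hd.1, by omega⟩, if_pos ⟨hd.1, rfl, hd.2.symm⟩, hd.2]
      simp
    · rw [if_neg (by omega), if_neg (by tauto)]
      simp
  · intro m _ hm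
    rw [if_neg (by tauto), smul_zero]
  · intro hm
    rw [Finset.mem_range] at hm
    rw [superCount_eq_zero (by omega)]
    simp

lemma inv_mul_substTwo_superTrunc (N : ℕ) :
    kernelDenominator⁻¹ * substTwo (superTrunc N) (X 1) (X 2 * (kernelDenominator ^ 2)⁻¹) =
      ∑ l ∈ Finset.range N, kernelDenominator⁻¹ ^ (2 * l + 1) * (superLength (2 * l)).gf := by
  rw [inv_sq, superTrunc, substTwo, ← substAlgHom_apply (hasSubst_two _), map_sum, Finset.mul_sum]
  refine Finset.sum_congr rfl fun l _ => ?_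
  rw [map_sum, Finset.mul_sum, superLength_even, Finset.mul_sum]
  refine Finset.sum_congr rfl fun m _ => ?_
  rw [substAlgHom_apply, show subst _ _ = _ from substTwo_monomial _ _ _, mul_smul_comm, mul_smul_comm, exponentTwo_zero,
    exponentTwo_one]
  congr 1
  ring

lemma coeff_X_pow_mul_eq_zero {i : Fin 3} {n : ℕ} {d : Fin 3 →₀ ℕ} (h : d i < n)
    (F : MvPowerSeries (Fin 3) ℚ) : MvPowerSeries.coeff d (X i ^ n * F) = 0 :=
  X_pow_dvd_iff.1 (dvd_mul_right _ _) d h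

/-- For a coefficient of degree `d 2` in `z`, it suffices to compare the sums over `l ≤ d 2`. The
remainders vanish there: walks in `rootedFrom (2 * (d 2 + 1))` are too long, and the rest of `S` is
divisible by `z ^ (d 2 + 1)` after substitution. -/
lemma rootedFrom_zero_eq_subst : (rootedFrom 0).gf =
    kernelDenominator⁻¹ * substTwo superGF (X 1) (X 2 * (kernelDenominator ^ 2)⁻¹) := by
  ext d
  have hF : superGF = superTrunc (d 2 + 1) + (superGF - superTrunc (d 2 + 1)) := by ring
  rw [hF, rootedFrom_zero_eq_sum (d 2 + 1), substTwo, subst_add (hasSubst_two _), mul_add kernelDenominator⁻¹,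
    show _ * subst _ _ = _ from inv_mul_substTwo_superTrunc (d 2 + 1), map_add, map_add, add_right_inj]
  rw [coeff_mul_eq_zero, coeff_mul_eq_zero]
  · intro e he
    refine coeff_substTwo_eq_zero fun c hc => ?_
    have : d 2 + 1 ≤ c 1 := by
      by_contra! hlt
      exact hc (by rw [map_sub, coeff_superTrunc hlt, sub_self])
    rw [mul_pow, mul_left_comm]
    exact coeff_X_pow_mul_eq_zero (by have := he 2; omega) _
  · intro e he
    exact coeff_rootedFrom_eq_zero (by have := he 2; omega)

lemma kernelGF_functional : kernelGF =
    kernelDenominator⁻¹ * substTwo superGF (X 1) (X 2 * (kernelDenominator ^ 2)⁻¹) -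
      X 0 * X 1 * X 2 * (kernelGF - X 1) := by
  rw [← rootedFrom_zero_eq_subst, rootedFrom_zero_eq, rootedLeaf_eq, kernelGF_eq]
  have h3 := kernel_eq
  rw [singleton_eq] at h3 ⊢
  linear_combination X 0 * X 1 * X 2 * h3

/-- Kernel walks without simple edges are the superreduced walks. -/
lemma coeff_kernelGF_of_zero {d : Fin 3 →₀ ℕ} (hd : d 0 = 0) :
    MvPowerSeries.coeff d kernelGF = (superCount (d 1) (d 2) : ℚ) / (d 1).factorial := by
  rw [kernelGF_eq, coeff_gf, superCount_eq, ← eq_exponent_iff.2 ⟨hd, rfl, rfl⟩, ListClass.count,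
    ListClass.count]
  congr 3
  ext L
  refine ⟨fun hL => ⟨⟨hL.1.1.1, fun e he hc => ?_⟩, hL.2⟩, fun hL => ⟨?_, hL.2⟩⟩
  · have h : (simpleEdges L).card = 0 := by rw [← stat_zero, hL.2.2, hd]
    rw [Finset.card_eq_zero] at h
    have : e ∈ simpleEdges L := by simp [simpleEdges, he, hc]
    simp [h] at this
  · exact IsSuperreducedList.isKernelList hL.1

end FunctionalEquation

/-! ### Lagrange inversion and the expansion of `K` in powers of `u`. -/

section Lagrange

/-- Lagrange inversion: the coefficients of the powers of the solution `f` of `f = X φ(f)`. The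
equation is given in terms of coefficients. -/
theorem lagrange_inversion {R : Type*} [CommRing R] [NoZeroDivisors R] [CharZero R]
    {f φ : PowerSeries R}
    (h : ∀ k n, PowerSeries.coeff (n + k) (f ^ k) = ∑ j ∈ Finset.range (n + 1),
      PowerSeries.coeff j (φ ^ k) * PowerSeries.coeff n (f ^ j)) (n k : ℕ) :
    ((n + k : ℕ) : R) * PowerSeries.coeff (n + k) (f ^ k) =
      k * PowerSeries.coeff n (φ ^ (n + k)) := by
  have hX : ∀ (g : PowerSeries R) j,
      PowerSeries.coeff j (PowerSeries.X * PowerSeries.derivative R g) =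
        j * PowerSeries.coeff j g := by
    intro g j
    cases j with
    | zero => simp
    | succ j => rw [PowerSeries.coeff_succ_X_mul, PowerSeries.coeff_derivative]; push_cast; ring
  induction n using Nat.strong_induction_on generalizing k with
  | _ n ih =>
    rcases Nat.eq_zero_or_pos k with rfl | hk
    · rcases Nat.eq_zero_or_pos n with rfl | hn
      · simp
      · simp [PowerSeries.coeff_one, hn.ne']
    rcases Nat.eq_zero_or_pos n with rfl | hn
    · rw [h]
      simp
    -- The factor `n` lets the induction hypothesis apply to `n [X^n] f^j`, and it reappears from
    -- the derivative in `e3`.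
    refine mul_left_cancel₀ (Nat.cast_ne_zero.2 hn.ne' : (n : R) ≠ 0) ?_
    -- By induction `n [X^n] f^j = j [X^(n-j)] φ^n` for `j ≥ 1`, and the factor `j` turns `φ^k` into
    -- `X (φ^k)'`.
    have e1 : (n : R) * PowerSeries.coeff (n + k) (f ^ k) =
        PowerSeries.coeff n (PowerSeries.X * PowerSeries.derivative R (φ ^ k) * φ ^ n) := by
      rw [h, PowerSeries.coeff_mul, Finset.Nat.sum_antidiagonal_eq_sum_range_succ_mk,
        Finset.mul_sum]
      refine Finset.sum_congr rfl fun j hj => ?_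
      have hj' : j ≤ n := Nat.lt_succ_iff.1 (Finset.mem_range.1 hj)
      rw [hX]
      rcases Nat.eq_zero_or_pos j with rfl | hj0
      · simp [PowerSeries.coeff_one, hn.ne']
      · have := ih (n - j) (by omega) j
        rw [Nat.sub_add_cancel hj'] at this
        linear_combination PowerSeries.coeff j (φ ^ k) * this
    -- Both sides equal `k (n + k) X φ^(n+k-1) φ'`.
    have e2 : ((n + k : ℕ) : PowerSeries R) *
        (PowerSeries.X * PowerSeries.derivative R (φ ^ k) * φ ^ n) =
          (k : PowerSeries R) * (PowerSeries.X * PowerSeries.derivative R (φ ^ (n + k))) := by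
      obtain ⟨k, rfl⟩ := Nat.exists_eq_succ_of_ne_zero hk.ne'
      rw [Derivation.leibniz_pow, Derivation.leibniz_pow]
      simp only [nsmul_eq_mul, smul_eq_mul, Nat.succ_eq_add_one, Nat.add_sub_cancel,
        show n + (k + 1) - 1 = n + k by omega]
      ring
    have e3 := congrArg (PowerSeries.coeff n) e2
    rw [← map_natCast (PowerSeries.C (R := R)), ← map_natCast (PowerSeries.C (R := R)),
      PowerSeries.coeff_C_mul, PowerSeries.coeff_C_mul, hX, ← e1] at e3
    linear_combination e3

lemma coeff_expandFirst (F : MvPowerSeries (Fin 3) ℚ) (s : ℕ) (e : Fin 2 →₀ ℕ) :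
    MvPowerSeries.coeff e (PowerSeries.coeff s (expandFirst F)) =
      MvPowerSeries.coeff (e.cons s) F := by
  rw [expandFirst, coeff_coeff_finSuccEquiv]

lemma coeff_expandFirst_symm_C (G : MvPowerSeries (Fin 2) ℚ) (d : Fin 3 →₀ ℕ) :
    MvPowerSeries.coeff d (expandFirst.symm (PowerSeries.C G)) =
      if d 0 = 0 then MvPowerSeries.coeff d.tail G else 0 := by
  rw [← Finsupp.cons_tail d, ← coeff_expandFirst, AlgEquiv.apply_symm_apply, PowerSeries.coeff_C]
  simp only [Finsupp.cons_zero, Finsupp.tail_cons]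
  split_ifs <;> rfl

variable (A : MvPowerSeries (Fin 3) ℚ)

lemma hasSubst_three :
    HasSubst ![(X 0 * A : MvPowerSeries (Fin 3) ℚ), X 1, X 2] := by
  refine hasSubst_of_constantCoeff_zero fun i => ?_
  fin_cases i <;> simp

lemma subst_expandFirst_symm_C (G : MvPowerSeries (Fin 2) ℚ) :
    subst ![X 0 * A, X 1, X 2] (expandFirst.symm (PowerSeries.C G)) =
      expandFirst.symm (PowerSeries.C G) := by
  classical
  ext d
  rw [coeff_subst (hasSubst_three A), finsum_eq_single _ d]
  · by_cases hd : d 0 = 0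
    · have : (d.prod fun s n => ![X 0 * A, X 1, X 2] s ^ n) = monomial d (1 : ℚ) := by
        rw [Finsupp.prod_fintype _ _ (by simp), Fin.prod_univ_three,
          (eq_exponent_iff (d := d)).2 ⟨rfl, rfl, rfl⟩, monomial_exponent]
        simp [hd]
      rw [this]
      simp
    · rw [coeff_expandFirst_symm_C, if_neg hd, zero_smul]
  · intro c hc
    by_cases hc0 : c 0 = 0
    · have : (c.prod fun s n => ![X 0 * A, X 1, X 2] s ^ n) = monomial c (1 : ℚ) := by
        rw [Finsupp.prod_fintype _ _ (by simp), Fin.prod_univ_three,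
          (eq_exponent_iff (d := c)).2 ⟨rfl, rfl, rfl⟩, monomial_exponent]
        simp [hc0]
      rw [this, coeff_monomial, if_neg (Ne.symm hc), smul_zero]
    · rw [coeff_expandFirst_symm_C, if_neg hc0, zero_smul]

/-- Coefficientwise form of the composition `F(u A, v, z)`. The terms of `F` beyond degree `n` are
divisible by `u ^ (n + 1)` after substitution, and coefficients in `ℚ⟦v, z⟧` are fixed by it. -/
lemma coeff_expandFirst_subst (F : MvPowerSeries (Fin 3) ℚ) (n : ℕ) :
    PowerSeries.coeff n (expandFirst (subst ![X 0 * A, X 1, X 2] F)) =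
      ∑ j ∈ Finset.range (n + 1), PowerSeries.coeff j (expandFirst F) *
        PowerSeries.coeff n (expandFirst (X 0 * A) ^ j) := by
  obtain ⟨G, hG⟩ : ∃ G, expandFirst F = ∑ j ∈ Finset.range (n + 1),
      PowerSeries.X ^ j * PowerSeries.C (PowerSeries.coeff j (expandFirst F)) +
        PowerSeries.X ^ (n + 1) * G := by
    obtain ⟨G, hG⟩ : PowerSeries.X ^ (n + 1) ∣ expandFirst F - ∑ j ∈ Finset.range (n + 1),
        PowerSeries.X ^ j * PowerSeries.C (PowerSeries.coeff j (expandFirst F)) := by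
      rw [PowerSeries.X_pow_dvd_iff]
      intro m hm
      simp only [map_sub, map_sum, PowerSeries.coeff_mul_C, PowerSeries.coeff_X_pow]
      rw [Finset.sum_eq_single m]
      · simp
      · intro j _ hj
        rw [if_neg (Ne.symm hj), zero_mul]
      · intro hm'
        simp [hm] at hm'
    exact ⟨G, by rw [← hG]; ring⟩
  have hX0 : expandFirst (X 0) = PowerSeries.X := finSuccEquiv_X_zero
  have hF : F = ∑ j ∈ Finset.range (n + 1), X 0 ^ j *
      expandFirst.symm (PowerSeries.C (PowerSeries.coeff j (expandFirst F))) +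
        X 0 ^ (n + 1) * expandFirst.symm G := by
    apply expandFirst.injective
    simpa [map_sum, hX0] using hG
  have hs : subst ![X 0 * A, X 1, X 2] F = ∑ j ∈ Finset.range (n + 1), (X 0 * A) ^ j *
      expandFirst.symm (PowerSeries.C (PowerSeries.coeff j (expandFirst F))) +
        (X 0 * A) ^ (n + 1) * subst ![X 0 * A, X 1, X 2] (expandFirst.symm G) := by
    conv_lhs => rw [hF]
    rw [← substAlgHom_apply (hasSubst_three A), map_add, map_sum]
    have h0 : substAlgHom (hasSubst_three A) (X 0 : MvPowerSeries (Fin 3) ℚ) = X 0 * A := by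
      rw [substAlgHom_X]; rfl
    simp only [map_mul, map_pow, h0]
    simp only [substAlgHom_apply, subst_expandFirst_symm_C]
  rw [hs]
  simp only [map_add, map_sum, map_mul, map_pow, AlgEquiv.apply_symm_apply]
  rw [hX0, mul_pow PowerSeries.X _ (n + 1), mul_assoc, PowerSeries.coeff_X_pow_mul',
    if_neg (by omega), add_zero]
  refine Finset.sum_congr rfl fun j _ => ?_
  rw [PowerSeries.coeff_mul_C, mul_comm]

lemma subst_inv {a : Fin 3 → MvPowerSeries (Fin 3) ℚ} (ha : HasSubst a)
    {D : MvPowerSeries (Fin 3) ℚ} (h : constantCoeff D ≠ 0) (h' : constantCoeff (subst a D) ≠ 0) :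
    subst a D⁻¹ = (subst a D)⁻¹ := by
  rw [MvPowerSeries.eq_inv_iff_mul_eq_one h', ← subst_mul ha, MvPowerSeries.inv_mul_cancel _ h,
    ← substAlgHom_apply ha, map_one]

/-- With `t = u (K - v)` the series `1 - z t` becomes `1 - u z (K - v)`, so this is the functional
equation in the form `K - v = Φ(u (K - v))`. -/
lemma subst_lagrangeSeries :
    subst ![X 0 * (kernelGF - X 1), X 1, X 2] lagrangeSeries = kernelGF - X 1 := by
  have ha := hasSubst_three (kernelGF - X 1)
  set a : Fin 3 → MvPowerSeries (Fin 3) ℚ := ![X 0 * (kernelGF - X 1), X 1, X 2] with haa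
  have h0 : subst a (X 0 : MvPowerSeries (Fin 3) ℚ) = X 0 * (kernelGF - X 1) := by
    rw [subst_X ha]; rfl
  have h1 : subst a (X 1 : MvPowerSeries (Fin 3) ℚ) = X 1 := by rw [subst_X ha]; rfl
  have h2 : subst a (X 2 : MvPowerSeries (Fin 3) ℚ) = X 2 := by rw [subst_X ha]; rfl
  have hD : subst a (1 - X 2 * X 0 : MvPowerSeries (Fin 3) ℚ) = kernelDenominator := by
    rw [subst_sub ha, subst_mul ha, h0, h2, ← substAlgHom_apply ha, map_one, kernelDenominator]
    ring
  have hI : subst a (1 - X 2 * X 0 : MvPowerSeries (Fin 3) ℚ)⁻¹ = kernelDenominator⁻¹ := by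
    rw [subst_inv ha (by simp) (by rw [hD, constantCoeff_kernelDenominator]; simp), hD]
  rw [lagrangeSeries]
  simp only [subst_sub ha, subst_mul ha, hI, h0, h1, h2, inv_sq]
  rw [substTwo, subst_comp_subst_apply (hasSubst_two _) ha]
  have hfun : (fun s => subst a (![(X 1 : MvPowerSeries (Fin 3) ℚ),
      X 2 * (1 - X 2 * X 0)⁻¹ ^ 2] s)) = ![X 1, X 2 * (kernelDenominator ^ 2)⁻¹] := by
    funext i
    fin_cases i
    · exact h1
    · change subst a (X 2 * (1 - X 2 * X 0 : MvPowerSeries (Fin 3) ℚ)⁻¹ ^ 2) = _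
      rw [subst_mul ha, subst_pow ha, hI, h2, inv_sq]
      rfl
  rw [hfun]
  have := kernelGF_functional
  rw [substTwo] at this
  linear_combination -this

theorem coeff_expandFirst_kernelGF {s : ℕ} (hs : s ≠ 0) :
    PowerSeries.coeff s (expandFirst kernelGF) =
      (1 / ((s : ℚ) + 1)) • PowerSeries.coeff s (expandFirst (lagrangeSeries ^ (s + 1))) := by
  have hX0 : expandFirst (X 0) = PowerSeries.X := finSuccEquiv_X_zero
  have hX1 : expandFirst (X 1) = PowerSeries.C (X 0) := finSuccEquiv_X_succ 0
  have hpow : ∀ k : ℕ, expandFirst (X 0 * (kernelGF - X 1)) ^ k = PowerSeries.X ^ k *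
      expandFirst ((kernelGF - X 1) ^ k) := by
    intro k
    rw [map_mul, mul_pow, hX0, map_pow]
  have : CharZero (MvPowerSeries (Fin 2) ℚ) := algebraRat.charZero _
  -- Only the case `k = 1` is used; the summand `-v` is constant in `u` and disappears as `s ≠ 0`.
  have := lagrange_inversion (f := expandFirst (X 0 * (kernelGF - X 1)))
    (φ := expandFirst lagrangeSeries) (fun k n => by
      rw [hpow, PowerSeries.coeff_X_pow_mul]
      conv_lhs => rw [← subst_lagrangeSeries]
      rw [← subst_pow (hasSubst_three _), coeff_expandFirst_subst, map_pow]) s 1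
  rw [hpow, PowerSeries.coeff_X_pow_mul, pow_one, map_sub, map_sub, hX1, PowerSeries.coeff_C,
    if_neg hs, sub_zero, Nat.cast_one, one_mul, ← map_pow] at this
  rw [← this]
  have h1 : ((s : ℚ) + 1) ≠ 0 := by positivity
  have h2 : ((s + 1 : ℕ) : MvPowerSeries (Fin 2) ℚ) * PowerSeries.coeff s (expandFirst kernelGF) =
      ((s : ℚ) + 1) • PowerSeries.coeff s (expandFirst kernelGF) := by
    rw [← nsmul_eq_mul, ← Nat.cast_smul_eq_nsmul ℚ]
    push_cast
    rfl
  rw [h2, smul_smul, one_div_mul_cancel h1, one_smul]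

lemma coeff_zero_expandFirst_kernelGF :
    PowerSeries.coeff 0 (expandFirst kernelGF) = superGF := by
  ext e
  rw [coeff_expandFirst, coeff_kernelGF_of_zero (Finsupp.cons_zero _ _)]
  rfl

theorem expandFirst_kernelGF : expandFirst kernelGF =
    PowerSeries.C superGF + PowerSeries.mk fun s =>
      if s = 0 then 0
      else (1 / ((s : ℚ) + 1)) •
        PowerSeries.coeff s (expandFirst (lagrangeSeries ^ (s + 1))) := by
  ext1 s
  rw [map_add, PowerSeries.coeff_C, PowerSeries.coeff_mk]
  by_cases hs : s = 0
  · subst hs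
    rw [if_pos rfl, if_pos rfl, add_zero, coeff_zero_expandFirst_kernelGF]
  · rw [if_neg hs, if_neg hs, zero_add, coeff_expandFirst_kernelGF hs]

end Lagrange

/-! ### Weight bounds and the truncation of `S` by excess. -/

section Weights

/-- All monomials of the series have weight at least `c`. -/
def WeightGE (w : (Fin 3 →₀ ℕ) →+ ℤ) (c : ℤ) (F : MvPowerSeries (Fin 3) ℚ) : Prop :=
  ∀ d, MvPowerSeries.coeff d F ≠ 0 → c ≤ w d

namespace WeightGE

variable {w : (Fin 3 →₀ ℕ) →+ ℤ} {c c' : ℤ} {F G : MvPowerSeries (Fin 3) ℚ}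

lemma add (hF : WeightGE w c F) (hG : WeightGE w c G) : WeightGE w c (F + G) := by
  intro d hd
  by_cases h : MvPowerSeries.coeff d F = 0
  · exact hG d fun h' => hd (by rw [map_add, h, h', add_zero])
  · exact hF d h

lemma neg (hF : WeightGE w c F) : WeightGE w c (-F) :=
  fun d hd => hF d fun h => hd (by rw [map_neg, h, neg_zero])

lemma sub (hF : WeightGE w c F) (hG : WeightGE w c G) : WeightGE w c (F - G) := by
  rw [sub_eq_add_neg]
  exact hF.add hG.neg

lemma mul (hF : WeightGE w c F) (hG : WeightGE w c' G) : WeightGE w (c + c') (F * G) := by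
  classical
  intro d hd
  rw [coeff_mul] at hd
  obtain ⟨q, hq, hne⟩ := Finset.exists_ne_zero_of_sum_ne_zero hd
  have h1 := hF q.1 (left_ne_zero_of_mul hne)
  have h2 := hG q.2 (right_ne_zero_of_mul hne)
  rw [← Finset.HasAntidiagonal.mem_antidiagonal.1 hq, map_add]
  omega

lemma monomial (e : Fin 3 →₀ ℕ) : WeightGE w (w e) (MvPowerSeries.monomial e (1 : ℚ)) := by
  classical
  intro d hd
  rw [coeff_monomial] at hd
  rw [(ite_ne_right_iff.1 hd).1]

lemma X (i : Fin 3) : WeightGE w (w (Finsupp.single i 1)) (MvPowerSeries.X i) := monomial _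

lemma one : WeightGE w 0 1 := by
  have := monomial (w := w) 0
  rwa [map_zero] at this

lemma pow (hF : WeightGE w c F) (n : ℕ) : WeightGE w (n * c) (F ^ n) := by
  induction n with
  | zero => simpa using one
  | succ n ih =>
    rw [pow_succ]
    convert ih.mul hF using 1
    push_cast
    ring

lemma pow_of_nonneg (hF : WeightGE w 0 F) (n : ℕ) : WeightGE w 0 (F ^ n) := by
  simpa using hF.pow n

lemma pow_sub_pow (hF : WeightGE w 0 F) (hG : WeightGE w 0 G) (h : WeightGE w c (F - G)) (n : ℕ) :
    WeightGE w c (F ^ n - G ^ n) := by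
  induction n with
  | zero => intro d hd; simp at hd
  | succ n ih =>
    have : F ^ (n + 1) - G ^ (n + 1) = F ^ n * (F - G) + (F ^ n - G ^ n) * G := by ring
    rw [this]
    refine add ?_ ?_
    · simpa using (hF.pow_of_nonneg n).mul h
    · simpa using ih.mul hG

end WeightGE

/-- The series `1 / (1 - z t)`. -/
noncomputable def geom : MvPowerSeries (Fin 3) ℚ := (1 - X 2 * X 0)⁻¹

lemma geom_mul : geom * (1 - X 2 * X 0) = 1 := MvPowerSeries.inv_mul_cancel _ (by simp)

/-- Induction on the degree in `z` through `geom = 1 + z t * geom`. -/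
lemma weightGE_geom {w : (Fin 3 →₀ ℕ) →+ ℤ}
    (hw : 0 ≤ w (Finsupp.single 0 1 + Finsupp.single 2 1)) : WeightGE w 0 geom := by
  have h : geom = 1 + monomial (Finsupp.single 0 1 + Finsupp.single 2 1) 1 * geom := by
    rw [ListClass.monomial_eq]
    linear_combination geom_mul
  intro d
  induction hn : d 2 using Nat.strong_induction_on generalizing d with
  | _ n ih =>
    intro hd
    rw [h, map_add, coeff_monomial_mul] at hd
    split_ifs at hd with hle
    · obtain ⟨e, rfl⟩ := exists_add_of_le hle
      rw [add_tsub_cancel_left, one_mul] at hd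
      rw [map_add]
      by_cases he : MvPowerSeries.coeff e geom = 0
      · rw [he, add_zero] at hd
        have := WeightGE.one (w := w) _ hd
        rwa [map_add] at this
      · have := ih (e 2) (by rw [← hn]; simp) e rfl he
        omega
    · rw [add_zero] at hd
      exact WeightGE.one d hd

lemma weightGE_substTwo {w : (Fin 3 →₀ ℕ) →+ ℤ} {c : ℤ} {F : MvPowerSeries (Fin 2) ℚ}
    {G : MvPowerSeries (Fin 3) ℚ} (hG : WeightGE w 0 G)
    (h : ∀ e, MvPowerSeries.coeff e F ≠ 0 →
      c ≤ e 0 * w (Finsupp.single 1 1) + e 1 * w (Finsupp.single 2 1)) :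
    WeightGE w c (substTwo F (X 1) (X 2 * G)) := by
  intro d hd
  by_contra hlt
  refine hd (coeff_substTwo_eq_zero fun e he => ?_)
  by_contra hne
  have h1 := ((WeightGE.X 1).pow (e 0)).mul (((WeightGE.X 2).mul hG).pow (e 1)) d hne
  rw [add_zero] at h1
  exact hlt ((h e he).trans h1)

/-- The weight `ℓ - m`. -/
noncomputable def weight : (Fin 3 →₀ ℕ) →+ ℤ where
  toFun d := (d 2 : ℤ) - d 1
  map_zero' := by simp
  map_add' d e := by simp; ring

/-- The weight `2 (ℓ - m) - s`. -/
noncomputable def weightTwo : (Fin 3 →₀ ℕ) →+ ℤ where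
  toFun d := 2 * ((d 2 : ℤ) - d 1) - d 0
  map_zero' := by simp
  map_add' d e := by simp; ring

lemma weight_apply (d : Fin 3 →₀ ℕ) : weight d = (d 2 : ℤ) - d 1 := rfl
lemma weightTwo_apply (d : Fin 3 →₀ ℕ) : weightTwo d = 2 * ((d 2 : ℤ) - d 1) - d 0 := rfl

/-- The series `1 / (1 - z t) * F(v, z / (1 - z t)^2) - v z t - v`. -/
noncomputable def lagrangeTransform (F : MvPowerSeries (Fin 2) ℚ) : MvPowerSeries (Fin 3) ℚ :=
  geom * substTwo F (X 1) (X 2 * geom ^ 2) - X 1 * X 2 * X 0 - X 1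

lemma lagrangeSeries_eq : lagrangeSeries = lagrangeTransform superGF := by
  simp only [lagrangeSeries, lagrangeTransform, inv_sq, geom]

lemma lagrangeTransform_sub (F G : MvPowerSeries (Fin 2) ℚ) :
    lagrangeTransform F - lagrangeTransform G =
      geom * substTwo (F - G) (X 1) (X 2 * geom ^ 2) := by
  rw [lagrangeTransform, lagrangeTransform, substTwo, substTwo, substTwo,
    subst_sub (hasSubst_two _)]
  ring

/-- The only term of `S` with `m > ℓ` is `v`, from the walk of length `0`. The subtracted terms
repair it: `v / (1 - z t) - v z t - v = v (z t)² / (1 - z t)`, and `v z² t²` has weight `0`. -/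
lemma weightGE_weightTwo_lagrangeSeries : WeightGE weightTwo 0 lagrangeSeries := by
  classical
  have hg : WeightGE weightTwo 0 geom := weightGE_geom (by simp [weightTwo_apply])
  have h1 : lagrangeSeries = X 1 * (X 2 * X 0) ^ 2 * geom +
      geom * substTwo (superGF - X 0) (X 1) (X 2 * geom ^ 2) := by
    have h0 : substTwo (X 0) (X 1) (X 2 * geom ^ 2) = X 1 := by
      rw [substTwo, subst_X (hasSubst_two _)]; rfl
    rw [lagrangeSeries_eq, lagrangeTransform, substTwo, substTwo, subst_sub (hasSubst_two _),
      show subst _ _ = _ from h0]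
    linear_combination X 1 * (1 + X 2 * X 0) * geom_mul
  rw [h1]
  refine WeightGE.add ?_ ?_
  · have := ((WeightGE.X (w := weightTwo) 1).mul
      (((WeightGE.X 2).mul (WeightGE.X 0)).pow 2)).mul hg
    simpa [weightTwo_apply] using this
  · have := hg.mul (weightGE_substTwo (c := 0) (F := superGF - X 0) (hg.pow_of_nonneg 2)
      fun e he => ?_)
    · simpa using this
    · simp only [map_sub, coeff_superGF, coeff_X] at he
      have hle : e 0 ≤ e 1 := by
        by_contra! hlt
        apply he
        have h2 : superCount (e 0) (e 1) ≠ 0 → e 0 = 1 ∧ e 1 = 0 := by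
          intro hne
          have h3 : ¬ e 1 + 2 < 2 * e 0 := fun h => hne (superCount_eq_zero h)
          omega
        by_cases hne : superCount (e 0) (e 1) = 0
        · rw [hne, if_neg]
          · simp
          · rintro rfl
            simp [superCount_one_zero] at hne
        · obtain ⟨h3, h4⟩ := h2 hne
          have h5 : e = Finsupp.single 0 1 := by
            ext i
            fin_cases i
            · simpa using h3
            · simpa using h4
          rw [h3, h4, if_pos h5, superCount_one_zero]
          simp
      simp [weightTwo_apply]
      omega

lemma weightGE_weight_of_weightTwo {F : MvPowerSeries (Fin 3) ℚ} (h : WeightGE weightTwo 0 F) :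
    WeightGE weight 0 F := by
  intro d hd
  have := h d hd
  rw [weightTwo_apply] at this
  rw [weight_apply]
  omega

lemma coeff_superGFExcessLE (ξ : ℕ) (e : Fin 2 →₀ ℕ) :
    MvPowerSeries.coeff e (superGFExcessLE ξ) =
      if e 1 + 1 ≤ e 0 + ξ then MvPowerSeries.coeff e superGF else 0 := by
  have h : ∀ k, MvPowerSeries.coeff e (superGFExcess k) =
      if e 0 + k = e 1 + 1 then MvPowerSeries.coeff e superGF else 0 := by
    intro k
    change (superCountExcess k (e 0) (e 1) : ℚ) / (e 0).factorial = _
    rw [superCountExcess_eq, coeff_superGF]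
    split_ifs <;> simp
  rw [superGFExcessLE, map_sum]
  simp only [h]
  by_cases hlt : e 1 + 1 < e 0
  · have : MvPowerSeries.coeff e superGF = 0 := by
      rw [coeff_superGF, superCount_eq_zero (by omega)]
      simp
    simp [this]
  · split_ifs with hle
    · rw [Finset.sum_eq_single (e 1 + 1 - e 0), if_pos (by omega)]
      · intro k _ hk
        rw [if_neg (by omega)]
      · intro hk
        rw [Finset.mem_range] at hk
        omega
    · refine Finset.sum_eq_zero fun k hk => ?_
      rw [Finset.mem_range] at hk
      rw [if_neg (by omega)]

/-- From `2 m ≤ ℓ + 2` and `ℓ + 1 ≤ m + ξ` follow `m ≤ ξ + 1` and `ℓ ≤ 2 ξ`. -/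
lemma exists_superGFExcessLE_eq_coe (ξ : ℕ) :
    ∃ P : MvPolynomial (Fin 2) ℚ, (P : MvPowerSeries (Fin 2) ℚ) = superGFExcessLE ξ := by
  refine ⟨trunc' ℚ (exponentTwo (ξ + 1) (2 * ξ)) (superGFExcessLE ξ), ?_⟩
  ext e
  rw [MvPolynomial.coeff_coe, coeff_trunc']
  split_ifs with h
  · rfl
  · symm
    rw [coeff_superGFExcessLE]
    split_ifs with h1
    · rw [coeff_superGF]
      by_cases h2 : e 1 + 2 < 2 * e 0
      · rw [superCount_eq_zero h2]
        simp
      · exfalso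
        refine h fun i => ?_
        fin_cases i
        · simp; omega
        · simp; omega
    · rfl

lemma weightGE_lagrangeTransform_sub (ξ : ℕ) : WeightGE weight ξ
    (lagrangeSeries - lagrangeTransform (superGFExcessLE ξ)) := by
  have hg : WeightGE weight 0 geom := weightGE_geom (by simp [weight_apply])
  rw [lagrangeSeries_eq, lagrangeTransform_sub]
  have := hg.mul (weightGE_substTwo (c := ξ) (F := superGF - superGFExcessLE ξ)
    (hg.pow_of_nonneg 2) fun e he => ?_)
  · simpa using this
  · rw [map_sub, coeff_superGFExcessLE] at he
    split_ifs at he with h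
    · simp at he
    · simp [weight_apply]
      omega

/-- The two powers differ only in weights at least `ξ`, while `d` has weight `ξ - 1`. -/
lemma coeff_lagrangeSeries_pow {ξ : ℕ} {d : Fin 3 →₀ ℕ} (hd : d 1 + ξ = d 2 + 1) (n : ℕ) :
    MvPowerSeries.coeff d (lagrangeSeries ^ n) =
      MvPowerSeries.coeff d (lagrangeTransform (superGFExcessLE ξ) ^ n) := by
  have h1 := weightGE_weight_of_weightTwo weightGE_weightTwo_lagrangeSeries
  have h2 := weightGE_lagrangeTransform_sub ξ
  have h3 : WeightGE weight 0 (lagrangeTransform (superGFExcessLE ξ)) := by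
    have h4 : WeightGE weight 0 (lagrangeSeries - lagrangeTransform (superGFExcessLE ξ)) :=
      fun d hd => (Int.natCast_nonneg ξ).trans (h2 d hd)
    simpa using h1.sub h4
  have h5 := h1.pow_sub_pow h3 h2 n
  by_contra hne
  have := h5 d (by rwa [map_sub, sub_ne_zero])
  rw [weight_apply] at this
  omega

end Weights

/-! ### Marking the weight by `y`, and the formula for fixed excess. -/

section Laurent

/-- The Laurent series `G` in `y` is obtained from `F` by multiplying each monomial with the power
of `y` given by its weight. -/
def IsGrading (G : LaurentSeries (MvPowerSeries (Fin 3) ℚ)) (F : MvPowerSeries (Fin 3) ℚ) : Prop :=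
  ∀ k d, MvPowerSeries.coeff d (G.coeff k) = if weight d = k then MvPowerSeries.coeff d F else 0

namespace IsGrading

variable {G G' : LaurentSeries (MvPowerSeries (Fin 3) ℚ)} {F F' : MvPowerSeries (Fin 3) ℚ}

lemma unique (h : IsGrading G F) (h' : IsGrading G' F) : G = G' := by
  ext k d
  rw [h, h']

lemma add (h : IsGrading G F) (h' : IsGrading G' F') : IsGrading (G + G') (F + F') := by
  intro k d
  rw [HahnSeries.coeff_add, map_add, map_add, h, h']
  split_ifs <;> simp

lemma sub (h : IsGrading G F) (h' : IsGrading G' F') : IsGrading (G - G') (F - F') := by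
  intro k d
  rw [HahnSeries.coeff_sub, map_sub, map_sub, h, h']
  split_ifs <;> simp

/-- The weight is additive, so for each way to split the monomial `d` only one pair of exponents of
`y` can contribute. -/
lemma mul (h : IsGrading G F) (h' : IsGrading G' F') : IsGrading (G * G') (F * F') := by
  classical
  intro k d
  rw [HahnSeries.coeff_mul, map_sum]
  simp only [coeff_mul]
  rw [Finset.sum_comm]
  have key : ∀ p ∈ Finset.HasAntidiagonal.antidiagonal d,
      (∑ x ∈ Finset.antidiagonal G.isPWO_support G'.isPWO_support k,
        MvPowerSeries.coeff p.1 (G.coeff x.1) * MvPowerSeries.coeff p.2 (G'.coeff x.2)) =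
        if weight d = k then MvPowerSeries.coeff p.1 F * MvPowerSeries.coeff p.2 F' else 0 := by
    rintro ⟨p, q⟩ hpq
    have hw : weight d = weight p + weight q := by
      rw [← Finset.HasAntidiagonal.mem_antidiagonal.1 hpq, map_add]
    have hp : MvPowerSeries.coeff p (G.coeff (weight p)) = MvPowerSeries.coeff p F := by
      rw [h, if_pos rfl]
    have hq : MvPowerSeries.coeff q (G'.coeff (weight q)) = MvPowerSeries.coeff q F' := by
      rw [h', if_pos rfl]
    split_ifs with hk
    · rw [Finset.sum_eq_single (weight p, weight q)]
      · rw [hp, hq]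
      · rintro ⟨i, j⟩ _ hij
        simp only [h i p, h' j q]
        by_cases hi : weight p = i
        · rw [if_neg (c := weight q = j) fun hj => hij (by rw [hi, hj]), mul_zero]
        · rw [if_neg hi, zero_mul]
      · intro hmem
        simp only [Finset.mem_antidiagonal, HahnSeries.mem_support, not_and_or, not_not] at hmem
        rcases hmem with hmem | hmem | hmem
        · rw [hmem, map_zero, zero_mul]
        · rw [hmem, map_zero, mul_zero]
        · exact absurd (hw.symm.trans hk) hmem
    · refine Finset.sum_eq_zero ?_
      rintro ⟨i, j⟩ hij
      simp only [Finset.mem_antidiagonal] at hij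
      simp only [h i p, h' j q]
      by_cases hi : weight p = i
      · rw [if_neg (c := weight q = j) (by omega), mul_zero]
      · rw [if_neg hi, zero_mul]
  rw [Finset.sum_congr rfl key]
  split_ifs <;> simp

lemma single {k : ℤ} (h : ∀ d, MvPowerSeries.coeff d F ≠ 0 → weight d = k) :
    IsGrading (HahnSeries.single k F) F := by
  intro j d
  by_cases hj : j = k
  · subst hj
    rw [HahnSeries.coeff_single_same]
    split_ifs with hd
    · rfl
    · by_contra hne
      exact hd (h d hne)
  · rw [HahnSeries.coeff_single_of_ne hj, map_zero]
    split_ifs with hd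
    · by_contra hne
      exact hj (by rw [← hd, h d (Ne.symm hne)])
    · rfl

lemma single_monomial (e : Fin 3 →₀ ℕ) (r : ℚ) :
    IsGrading (HahnSeries.single (weight e) (monomial e r)) (monomial e r) := by
  classical
  refine single fun d hd => ?_
  rw [coeff_monomial] at hd
  rw [(ite_ne_right_iff.1 hd).1]

lemma one : IsGrading 1 1 := by
  have := single_monomial 0 1
  rwa [map_zero] at this

lemma pow (h : IsGrading G F) (n : ℕ) : IsGrading (G ^ n) (F ^ n) := by
  induction n with
  | zero => simpa using one
  | succ n ih => rw [pow_succ, pow_succ]; exact ih.mul h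

lemma aeval {a : Fin 2 → LaurentSeries (MvPowerSeries (Fin 3) ℚ)}
    {b : Fin 2 → MvPowerSeries (Fin 3) ℚ} (h : ∀ i, IsGrading (a i) (b i))
    (P : MvPolynomial (Fin 2) ℚ) : IsGrading (MvPolynomial.aeval a P) (MvPolynomial.aeval b P) := by
  induction P using MvPolynomial.induction_on with
  | C r =>
    rw [MvPolynomial.aeval_C, MvPolynomial.aeval_C]
    -- Ring homomorphisms out of `ℚ` are unique, so scalars are constant Laurent series.
    have h1 : algebraMap ℚ (LaurentSeries (MvPowerSeries (Fin 3) ℚ)) r =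
        HahnSeries.C (algebraMap ℚ (MvPowerSeries (Fin 3) ℚ) r) :=
      RingHom.congr_fun (Subsingleton.elim _
        ((HahnSeries.C : _ →+* LaurentSeries (MvPowerSeries (Fin 3) ℚ)).comp
          (algebraMap ℚ (MvPowerSeries (Fin 3) ℚ)))) r
    have := single_monomial 0 r
    rw [map_zero] at this
    rw [h1]
    exact this
  | add p q hp hq => rw [map_add, map_add]; exact hp.add hq
  | mul_X p i hp =>
    rw [map_mul, map_mul, MvPolynomial.aeval_X, MvPolynomial.aeval_X]
    exact hp.mul (h i)

/-- Nonnegative weights keep the exponents of `y` bounded below. -/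
lemma exists_of_weightGE (h : WeightGE weight 0 F) : ∃ G, IsGrading G F := by
  refine ⟨HahnSeries.ofSuppBddBelow (fun k d => if weight d = k then MvPowerSeries.coeff d F else 0)
    ⟨0, fun k hk => ?_⟩, fun k d => rfl⟩
  by_contra! hlt
  refine hk (funext fun d => ?_)
  change (if weight d = k then MvPowerSeries.coeff d F else 0) = 0
  split_ifs with hd
  · by_contra hne
    have := h d hne
    omega
  · rfl

end IsGrading

lemma isGrading_lagrangeLaurent (P : MvPolynomial (Fin 2) ℚ) :
    IsGrading (lagrangeLaurent P) (lagrangeTransform (P : MvPowerSeries (Fin 2) ℚ)) := by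
  have hX : ∀ i : Fin 3, IsGrading (HahnSeries.single (weight (Finsupp.single i 1))
      (X i : MvPowerSeries (Fin 3) ℚ)) (X i) := fun i => IsGrading.single_monomial _ _
  have ht : IsGrading (HahnSeries.C (X 0)) (X 0) := by simpa [weight_apply] using hX 0
  have hv : IsGrading (HahnSeries.single (-1) (X 1)) (X 1) := by simpa [weight_apply] using hX 1
  have hz : IsGrading (HahnSeries.single 1 (X 2)) (X 2) := by simpa [weight_apply] using hX 2
  have hvzt : IsGrading (HahnSeries.C (X 1 * X 2 * X 0)) (X 1 * X 2 * X 0) := by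
    have := (hv.mul hz).mul ht
    rwa [HahnSeries.C_apply, HahnSeries.single_mul_single, HahnSeries.single_mul_single] at this
  -- The inverse of `1 - y z t` is obtained by grading `1 / (1 - z t)`; uniqueness of gradings turns
  -- `geom_mul` into the required identity.
  obtain ⟨Q, hQ⟩ := IsGrading.exists_of_weightGE (weightGE_geom (w := weight)
    (by simp [weight_apply]))
  have hden := IsGrading.one.sub (hz.mul ht)
  have hQ1 : Q * (1 - HahnSeries.single 1 (X 2) * HahnSeries.C (X 0)) = 1 := by
    refine (hQ.mul hden).unique ?_
    rw [geom_mul]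
    exact IsGrading.one
  have hinv : Ring.inverse ((1 : LaurentSeries (MvPowerSeries (Fin 3) ℚ)) -
      HahnSeries.single 1 (X 2) * HahnSeries.C (X 0)) = Q := by
    have hu : IsUnit ((1 : LaurentSeries (MvPowerSeries (Fin 3) ℚ)) -
        HahnSeries.single 1 (X 2) * HahnSeries.C (X 0)) :=
      IsUnit.of_mul_eq_one Q (by rw [mul_comm, hQ1])
    have := (Ring.eq_mul_inverse_iff_mul_eq Q 1 _ hu).2 hQ1
    rw [this, one_mul]
  rw [lagrangeTransform, substTwo, subst_coe]
  simp only [lagrangeLaurent, hinv]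
  refine ((hQ.mul (IsGrading.aeval (fun i => ?_) P)).sub hvzt).sub hv
  fin_cases i
  · exact hv
  · exact hz.mul (hQ.pow 2)

theorem expandFirst_kernelGFExcess (ξ : ℕ) (P : MvPolynomial (Fin 2) ℚ)
    (hP : (P : MvPowerSeries (Fin 2) ℚ) = superGFExcessLE ξ) :
    expandFirst (kernelGFExcess ξ) = PowerSeries.C (superGFExcess ξ) +
      ∑ s ∈ Finset.Icc 1 (2 * ξ - 2), PowerSeries.X ^ s * PowerSeries.C ((1 / ((s : ℚ) + 1)) •
        PowerSeries.coeff s (expandFirst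
          ((lagrangeLaurent P ^ (s + 1)).coeff ((ξ : ℤ) - 1)))) := by
  ext s e
  have hd0 : (e.cons s : Fin 3 →₀ ℕ) 0 = s := Finsupp.cons_zero _ _
  have hd1 : (e.cons s : Fin 3 →₀ ℕ) 1 = e 0 := Finsupp.cons_succ 0 _ _
  have hd2 : (e.cons s : Fin 3 →₀ ℕ) 2 = e 1 := Finsupp.cons_succ 1 _ _
  have hsum : PowerSeries.coeff s (∑ s ∈ Finset.Icc 1 (2 * ξ - 2), PowerSeries.X ^ s *
      PowerSeries.C ((1 / ((s : ℚ) + 1)) • PowerSeries.coeff s (expandFirst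
        ((lagrangeLaurent P ^ (s + 1)).coeff ((ξ : ℤ) - 1))))) =
      if s ∈ Finset.Icc 1 (2 * ξ - 2) then (1 / ((s : ℚ) + 1)) • PowerSeries.coeff s (expandFirst
        ((lagrangeLaurent P ^ (s + 1)).coeff ((ξ : ℤ) - 1))) else 0 := by
    simp only [map_sum, PowerSeries.coeff_mul_C, PowerSeries.coeff_X_pow, ite_mul, one_mul,
      zero_mul, Finset.sum_ite_eq]
  rw [coeff_expandFirst, coeff_kernelGFExcess_eq, hd1, hd2, map_add, hsum, PowerSeries.coeff_C,
    map_add]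
  by_cases hs : s = 0
  · subst hs
    rw [if_neg (c := (0 : ℕ) ∈ Finset.Icc 1 (2 * ξ - 2)) (by rw [Finset.mem_Icc]; omega),
      if_pos (c := (0 : ℕ) = 0) rfl, coeff_kernelGF_of_zero hd0, hd1, hd2, LinearMap.map_zero,
      add_zero]
    change _ = (superCountExcess ξ (e 0) (e 1) : ℚ) / (e 0).factorial
    rw [superCountExcess_eq]
    split_ifs <;> simp
  · have hK := congrArg (MvPowerSeries.coeff e) (coeff_expandFirst_kernelGF hs)
    rw [map_smul, coeff_expandFirst, coeff_expandFirst] at hK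
    rw [if_neg hs, LinearMap.map_zero, zero_add, hK]
    have hg : ∀ n, MvPowerSeries.coeff (e.cons s : Fin 3 →₀ ℕ)
        ((lagrangeLaurent P ^ n).coeff ((ξ : ℤ) - 1)) =
        if e 0 + ξ = e 1 + 1 then
          MvPowerSeries.coeff (e.cons s : Fin 3 →₀ ℕ) (lagrangeSeries ^ n) else 0 := by
      intro n
      rw [((isGrading_lagrangeLaurent P).pow n) _ _, weight_apply, hd1, hd2]
      by_cases h : e 0 + ξ = e 1 + 1
      · rw [if_pos h, if_pos (by omega), hP, ← coeff_lagrangeSeries_pow (by rwa [hd1, hd2])]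
      · rw [if_neg h, if_neg (by omega)]
    by_cases hmem : s ∈ Finset.Icc 1 (2 * ξ - 2)
    · rw [if_pos hmem, map_smul, coeff_expandFirst, hg]
      split_ifs <;> simp
    · rw [if_neg hmem, LinearMap.map_zero]
      split_ifs with h
      · have h0 : MvPowerSeries.coeff (e.cons s : Fin 3 →₀ ℕ) (lagrangeSeries ^ (s + 1)) = 0 := by
          by_contra hne
          have := weightGE_weightTwo_lagrangeSeries.pow_of_nonneg (s + 1) _ hne
          rw [weightTwo_apply, hd0, hd1, hd2] at this
          rw [Finset.mem_Icc] at hmem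
          omega
        rw [h0, smul_zero]
      · rfl

end Laurent

end TreeWalks

open TreeWalks in
theorem mainTheorem8 :
    -- the sum defining `K = ∑ ξ, K_ξ` is coefficientwise finite
    (∀ d : Fin 3 →₀ ℕ, {ξ : ℕ | MvPowerSeries.coeff d (kernelGFExcess ξ) ≠ 0}.Finite) ∧
    -- the functional equation
    (let u : MvPowerSeries (Fin 3) ℚ := MvPowerSeries.X 0
     let v : MvPowerSeries (Fin 3) ℚ := MvPowerSeries.X 1
     let z : MvPowerSeries (Fin 3) ℚ := MvPowerSeries.X 2
     let K := kernelGF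
     let D := 1 - u * z * (K - v)
     K = D⁻¹ * substTwo superGF v (z * (D ^ 2)⁻¹) - u * v * z * (K - v)) ∧
    -- the explicit formula for `K`, as power series in `u` over `ℚ⟦v, z⟧`
    (expandFirst kernelGF =
      PowerSeries.C superGF +
        PowerSeries.mk fun s =>
          if s = 0 then 0
          else (1 / ((s : ℚ) + 1)) •
            PowerSeries.coeff s (expandFirst (lagrangeSeries ^ (s + 1)))) ∧
    -- the explicit formula for `K_ξ`, with `S_{≤ ξ}` being a polynomial `P`
    (∀ ξ : ℕ, ∃ P : MvPolynomial (Fin 2) ℚ,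
      (P : MvPowerSeries (Fin 2) ℚ) = superGFExcessLE ξ ∧
      expandFirst (kernelGFExcess ξ) =
        PowerSeries.C (superGFExcess ξ) +
          ∑ s ∈ Finset.Icc 1 (2 * ξ - 2),
            PowerSeries.X ^ s * PowerSeries.C ((1 / ((s : ℚ) + 1)) •
              PowerSeries.coeff s (expandFirst
                ((lagrangeLaurent P ^ (s + 1)).coeff ((ξ : ℤ) - 1))))) := by
  refine ⟨finite_coeff_kernelGFExcess, kernelGF_functional, expandFirst_kernelGF, fun ξ => ?_⟩
  obtain ⟨P, hP⟩ := exists_superGFExcessLE_eq_coe ξ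
  exact ⟨P, hP, expandFirst_kernelGFExcess ξ P hP⟩
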